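/- Let $n\ge 6$, let $C$ be a set of $n$ control qubits of a finite qubit register, let $t\notin C$ be a target qubit of it, and let $W\in SU(2)$. The multi-controlled gate that applies $W$ to $t$ if all qubits of $C$ are in the state $|1\rangle$, and acts as the identity otherwise, can be implemented exactly and without ancilla (i.e. by a circuit that acts only on the qubits of $C\cup\{t\}$) using the following gates: the Hadamard gate $H$, the gates $T=\mathrm{diag}(1,e^{i\pi/4})$ and $T^\dagger$, CNOT gates between arbitrary pairs of distinct qubits (all-to-all connectivity), and the single-qubit rotations $R_x(\theta)=e^{-i\theta X/2}$ and $R_z(\theta)=e^{-i\theta Z/2}$ with arbitrary $\theta\in\mathbb{R}$. A circuit is a sequence of layers (time slots), where the gates of one layer act on pairwise disjoint sets of qubits. The cost of a type of gate is the number of gates of that type in the circuit, and its depth is the number of layers that contain at least one gate of that type; both $T$ and $T^\dagger$ count as T gates. There is a single circuit that implements the gate with exactly eight gates of the form $R_x(\theta)$ or $R_z(\theta)$ and, at the same time, - CNOT cost $12n-32$ and CNOT depth $8n-8$; - T cost $16n-48$, and T depth $8n-6$ if $n$ is even, $8n-3$ if $n$ is odd; - H cost $8n-32$ and H depth $4n-11$.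 -/

import Mathlib

open Matrix

noncomputable section

/-- A computational basis state of the register with qubit set `Q`: one bit for each qubit. -/
abbrev BasisState (Q : Type*) := Q → Fin 2

/-- Operators on the state space `(ℂ²)^{⊗ Q}` of the register, written in the computational basis:
the entry `A x y` is `⟨x| A |y⟩`. -/
abbrev QOp (Q : Type*) := Matrix (BasisState Q) (BasisState Q) ℂ

/-! ### Single-qubit matrices -/

/-- The Pauli matrix `X`. -/
def pauliX : Matrix (Fin 2) (Fin 2) ℂ := !![0, 1; 1, 0]

/-- The Hadamard matrix. -/
def hadamard : Matrix (Fin 2) (Fin 2) ℂ :=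
  !![1 / (Real.sqrt 2 : ℂ), 1 / (Real.sqrt 2 : ℂ); 1 / (Real.sqrt 2 : ℂ), -1 / (Real.sqrt 2 : ℂ)]

/-- The phase matrix `P(θ) = diag(1, e^{iθ})`. -/
def phase (θ : ℝ) : Matrix (Fin 2) (Fin 2) ℂ := !![1, 0; 0, Complex.exp (θ * Complex.I)]

/-- The rotation `R_x(θ) = exp(-i (θ/2) X)`. -/
def rotX (θ : ℝ) : Matrix (Fin 2) (Fin 2) ℂ :=
  !![(Real.cos (θ / 2) : ℂ), -Complex.I * (Real.sin (θ / 2) : ℂ);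
     -Complex.I * (Real.sin (θ / 2) : ℂ), (Real.cos (θ / 2) : ℂ)]

/-- The rotation `R_z(θ) = exp(-i (θ/2) Z)`. -/
def rotZ (θ : ℝ) : Matrix (Fin 2) (Fin 2) ℂ :=
  !![Complex.exp (-(θ / 2 : ℝ) * Complex.I), 0; 0, Complex.exp ((θ / 2 : ℝ) * Complex.I)]

/-! ### Operators on the register -/

section Register

variable {Q : Type*} [Fintype Q] [DecidableEq Q]

/-- The operator which applies the `2 × 2` matrix `U` to qubit `t` and the identity to all others. -/
def applyTo (t : Q) (U : Matrix (Fin 2) (Fin 2) ℂ) : QOp Q :=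
  fun x y => if ∀ q, q ≠ t → x q = y q then U (x t) (y t) else 0

/-- The operator `U` on the qubit `t`, controlled by the set `C` of qubits: on a basis state `|y⟩` it
applies `U` to `t` if all qubits of `C` are in the state `|1⟩`, and acts as the identity otherwise. -/
def controlled (C : Finset Q) (t : Q) (U : Matrix (Fin 2) (Fin 2) ℂ) : QOp Q :=
  fun x y => if ∀ c ∈ C, y c = 1 then applyTo t U x y else (1 : QOp Q) x y

end Register

/-! ### Gates and circuits -/

/-- The available gates, each with the qubits on which it acts. A CNOT may act on any two distinct
qubits (all-to-all connectivity). -/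
inductive Gate (Q : Type*) where
  | H (q : Q)
  | T (q : Q)
  | Tdg (q : Q)
  | CNOT (c t : Q) (hne : c ≠ t)
  | Rx (θ : ℝ) (q : Q)
  | Rz (θ : ℝ) (q : Q)

namespace Gate

variable {Q : Type*}

def isCNOT : Gate Q → Bool
  | CNOT _ _ _ => true
  | _ => false

/-- `T` and its inverse both count as T gates. -/
def isT : Gate Q → Bool
  | T _ => true
  | Tdg _ => true
  | _ => false

def isH : Gate Q → Bool
  | H _ => true
  | _ => false

def isRotation : Gate Q → Bool
  | Rx _ _ => true
  | Rz _ _ => true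
  | _ => false

variable [DecidableEq Q]

/-- The qubits on which the gate acts. -/
def qubits : Gate Q → Finset Q
  | H q => {q}
  | T q => {q}
  | Tdg q => {q}
  | CNOT c t _ => {c, t}
  | Rx _ q => {q}
  | Rz _ q => {q}

variable [Fintype Q]

/-- The operator of the gate. -/
def op : Gate Q → QOp Q
  | H q => applyTo q hadamard
  | T q => applyTo q (phase (Real.pi / 4))
  | Tdg q => applyTo q (phase (-(Real.pi / 4)))
  | CNOT c t _ => controlled {c} t pauliX
  | Rx θ q => applyTo q (rotX θ)
  | Rz θ q => applyTo q (rotZ θ)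

end Gate

/-- A layer (time slot): gates that act on pairwise disjoint sets of qubits, and so can be executed in
parallel. -/
structure Layer (Q : Type*) [DecidableEq Q] where
  gates : List (Gate Q)
  disjoint : gates.Pairwise fun g g' => Disjoint g.qubits g'.qubits

/-- A circuit: a sequence of layers in order of time. -/
abbrev Circuit (Q : Type*) [DecidableEq Q] := List (Layer Q)

namespace Circuit

variable {Q : Type*} [DecidableEq Q]

/-- All gates of the circuit in order of time. -/
def gates (c : Circuit Q) : List (Gate Q) := c.flatMap Layer.gates

/-- The number of gates of the kind `p`. -/
def cost (p : Gate Q → Bool) (c : Circuit Q) : ℕ := (gates c).countP p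

/-- The depth of the gates of the kind `p`: the number of layers that hold such a gate. -/
def depth (p : Gate Q → Bool) (c : Circuit Q) : ℕ := c.countP fun L => L.gates.any p

/-- The circuit acts on qubits of `S` only. -/
def ActsOn (c : Circuit Q) (S : Finset Q) : Prop := ∀ g ∈ gates c, g.qubits ⊆ S

/-- The operator of the circuit; the gates that come first in time are the rightmost factors. -/
def op [Fintype Q] (c : Circuit Q) : QOp Q := ((gates c).reverse.map Gate.op).prod

end Circuit

end

/-!
Up to a change of the rotation axis, `W = V R_x(l) V⁻¹` with `V = R_x(a) R_z(b)`
(`exists_rotX_rotZ_conj`), so it suffices to control `R_x(l)`. For `θ = -l / 4` and operators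
`P`, `P'` that are either `1` or `-iZ` on the target, the product
`R_x(-θ) P'⁻¹ R_x(θ) P⁻¹ R_x(-θ) P' R_x(θ) P` is `R_x(l)` if both are `-iZ` and `1` otherwise
(`iZ_rotX_commutator`). The circuit implements it with two kinds of blocks, each of which applies
`(-iZ)^{±1}` to the target under a condition on the controls.

The conditions are such that only their conjunction is the conjunction of all control bits. The
controls are split into `u_0, …, u_{k+2}` and `v_0, …, v_{k'+2}` with `k' ≤ k ≤ k' + 1`. The first
block checks `u_0 = 1` and `g_0 = 0`, where `g_j = v_j ⊕ u_{j+1} (1 ⊕ g_{j+1})` for `j < k` and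
`g_k = v_k ⊕ u_{k+1} u_{k+2}`; the second one does the same with `u` and `v` exchanged. So the
qubits `v_j` serve as borrowed targets for the values `g_j` although nothing is known about their
state. If both conditions hold, then `u_0 = v_0 = 1`, hence `u_1 = 1` and `g_1 = 0`, and in the same
way `v_1 = 1`, and so on (`ready_and_ready_iff`): each block certifies the initial values which the
other one takes for granted.

The values `g_j` are computed by a ladder of Toffoli gates, which may be replaced by relative-phase
Toffoli gates with four T gates and three CNOT gates each: the core of a block is diagonal, and a
diagonal operator conjugated by a permutation with phases is the permuted diagonal operator
(`Sends.diagonal_mul`, `Block.wordOp_word`). The first four gates of such a Toffoli gate do not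
depend on the value computed before, so they are executed for all rungs at once (`sends_ladder`);
this halves the depth. The last Hadamard layer of a block coincides with the first one of the next
block, and some of the T gates of the cores on the target share a layer with the T gates that open
the ladders.
-/

noncomputable section

/-! ### Operators that act on one qubit, conditioned on the others -/

section Fiber

theorem agree_off_iff {Q : Type*} [DecidableEq Q] {t : Q} {x y : BasisState Q} :
    (∀ q, q ≠ t → x q = y q) ↔ x = Function.update y t (x t) := by
  rw [Function.eq_update_iff]
  simp

variable {Q : Type*} [Fintype Q] [DecidableEq Q]

/-- The operator that applies to the qubit `t` a `2 × 2` matrix depending on the basis state of the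
register. It is a controlled operation on `t` when `F` does not depend on the bit of `t`; the lemmas
below assume this where it matters. -/
def fiberOp (t : Q) (F : BasisState Q → Matrix (Fin 2) (Fin 2) ℂ) : QOp Q :=
  fun x y => if ∀ q, q ≠ t → x q = y q then F y (x t) (y t) else 0

theorem fiberOp_mul (t : Q) {F : BasisState Q → Matrix (Fin 2) (Fin 2) ℂ}
    (G : BasisState Q → Matrix (Fin 2) (Fin 2) ℂ)
    (hF : ∀ x b, F (Function.update x t b) = F x) :
    fiberOp t F * fiberOp t G = fiberOp t fun x => F x * G x := by
  ext x y
  rw [Matrix.mul_apply, ← Finset.sum_subset (Finset.subset_univ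
    (Finset.univ.image fun b => Function.update y t b))]
  · rw [Finset.sum_image (fun a _ b _ h => Function.update_injective y t h)]
    by_cases hxy : ∀ q, q ≠ t → x q = y q
    · have h1 : ∀ b, ∀ q, q ≠ t → x q = Function.update y t b q := fun b q hq => by
        rw [Function.update_of_ne hq, hxy q hq]
      have h2 : ∀ b, ∀ q, q ≠ t → Function.update y t b q = y q := fun b q hq =>
        Function.update_of_ne hq _ _
      simp only [fiberOp, if_pos hxy, if_pos (h1 _), if_pos (h2 _), hF, Function.update_self,
        Matrix.mul_apply]
    · have h1 : ∀ b, ¬ ∀ q, q ≠ t → x q = Function.update y t b q := fun b h => hxy fun q hq => by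
        rw [h q hq, Function.update_of_ne hq]
      simp only [fiberOp, if_neg hxy, if_neg (h1 _), zero_mul, Finset.sum_const_zero]
  · intro z _ hz
    have : ¬ ∀ q, q ≠ t → z q = y q := fun h =>
      hz (Finset.mem_image.2 ⟨z t, Finset.mem_univ _, (agree_off_iff.1 h).symm⟩)
    simp only [fiberOp, if_neg this, mul_zero]

/-- The entry of a product of operators on different targets: only one intermediate basis state
contributes. -/
theorem fiberOp_mul_apply_of_ne {t s : Q} (hts : t ≠ s)
    {F G : BasisState Q → Matrix (Fin 2) (Fin 2) ℂ}
    (hF : ∀ x b, F (Function.update x s b) = F x) (x y : BasisState Q) :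
    (fiberOp t F * fiberOp s G) x y =
      if ∀ q, q ≠ t → q ≠ s → x q = y q then F y (x t) (y t) * G y (x s) (y s) else 0 := by
  rw [Matrix.mul_apply, Finset.sum_eq_single (Function.update y s (x s))]
  · have h2 : ∀ q, q ≠ s → Function.update y s (x s) q = y q := fun q hq =>
      Function.update_of_ne hq _ _
    have h1 : (∀ q, q ≠ t → x q = Function.update y s (x s) q) ↔
        ∀ q, q ≠ t → q ≠ s → x q = y q := by
      refine forall_congr' fun q => imp_congr_right fun hq => ?_
      by_cases hs : q = s
      · subst hs; simp
      · simp [hs]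
    simp only [fiberOp, if_pos h2, hF, Function.update_self, Function.update_of_ne hts, h1, ite_mul,
      zero_mul]
  · intro z _ hz
    by_cases h : ∀ q, q ≠ s → z q = y q
    · have : ¬ ∀ q, q ≠ t → x q = z q := fun h' => hz (by
        rw [agree_off_iff.1 h, h' s hts.symm, ← agree_off_iff.1 h])
      simp only [fiberOp, if_neg this, zero_mul]
    · simp only [fiberOp, if_neg h, mul_zero]
  · simp

theorem commute_fiberOp {t s : Q} (hts : t ≠ s)
    {F G : BasisState Q → Matrix (Fin 2) (Fin 2) ℂ}
    (hF : ∀ x b, F (Function.update x s b) = F x) (hG : ∀ x b, G (Function.update x t b) = G x) :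
    Commute (fiberOp t F) (fiberOp s G) := by
  ext x y
  rw [fiberOp_mul_apply_of_ne hts hF, fiberOp_mul_apply_of_ne hts.symm hG, mul_comm]
  congr 1
  exact propext ⟨fun h q h1 h2 => h q h2 h1, fun h q h1 h2 => h q h2 h1⟩

theorem fiberOp_one (t : Q) : fiberOp t (fun _ => 1) = 1 := by
  ext x y
  simp only [fiberOp, Matrix.one_apply]
  by_cases h : x = y
  · subst h; simp
  · rw [if_neg h]
    split_ifs with h1 h2
    · exact absurd (funext fun q => if hq : q = t then hq ▸ h2 else h1 q hq) h
    · rfl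
    · rfl

theorem controlled_eq_fiberOp (C : Finset Q) (t : Q) (U : Matrix (Fin 2) (Fin 2) ℂ) :
    controlled C t U = fiberOp t fun y => if ∀ c ∈ C, y c = 1 then U else 1 := by
  ext x y
  have h := congr_fun (congr_fun (fiberOp_one t) x) y
  by_cases hy : ∀ c ∈ C, y c = 1
  · simp only [controlled, fiberOp, applyTo, if_pos hy]
  · simp only [controlled, fiberOp, if_neg hy, ← h]

theorem fiberOp_eq_diagonal (t : Q) {F : BasisState Q → Matrix (Fin 2) (Fin 2) ℂ}
    (hF : ∀ x i j, i ≠ j → F x i j = 0) :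
    fiberOp t F = Matrix.diagonal fun x => F x (x t) (x t) := by
  ext x y
  by_cases h : x = y
  · subst h; simp [fiberOp]
  · rw [Matrix.diagonal_apply_ne _ h, fiberOp]
    split_ifs with h1
    · exact hF _ _ _ fun h2 => h (funext fun q => if hq : q = t then hq ▸ h2 else h1 q hq)
    · rfl

end Fiber

/-! ### Gates as conditioned operators, words of gates -/

namespace Gate

variable {Q : Type*}

/-- The qubit whose state a gate changes. -/
def target : Gate Q → Q
  | H q => q
  | T q => q
  | Tdg q => q
  | CNOT _ t _ => t
  | Rx _ q => q
  | Rz _ q => q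

/-- The matrix which a gate applies to its target, for a given basis state of the register. -/
def fiber : Gate Q → BasisState Q → Matrix (Fin 2) (Fin 2) ℂ
  | H _ => fun _ => hadamard
  | T _ => fun _ => phase (Real.pi / 4)
  | Tdg _ => fun _ => phase (-(Real.pi / 4))
  | CNOT c _ _ => fun y => if y c = 1 then pauliX else 1
  | Rx θ _ => fun _ => rotX θ
  | Rz θ _ => fun _ => rotZ θ

/-- The inverse gate. -/
def inv : Gate Q → Gate Q
  | H q => H q
  | T q => Tdg q
  | Tdg q => T q
  | CNOT c t h => CNOT c t h
  | Rx θ q => Rx (-θ) q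
  | Rz θ q => Rz (-θ) q

theorem target_inv (g : Gate Q) : g.inv.target = g.target := by cases g <;> rfl

variable [DecidableEq Q]

theorem qubits_inv (g : Gate Q) : g.inv.qubits = g.qubits := by cases g <;> rfl

theorem target_mem_qubits (g : Gate Q) : g.target ∈ g.qubits := by
  cases g <;> simp [target, qubits]

theorem fiber_update_of_notMem {g : Gate Q} {q : Q} (hq : q ∉ g.qubits) (x : BasisState Q)
    (b : Fin 2) : g.fiber (Function.update x q b) = g.fiber x := by
  cases g with
  | CNOT c t h =>
    have : c ≠ q := fun h => hq (by simp [qubits, h])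
    simp [fiber, this]
  | _ => rfl

theorem fiber_update_target (g : Gate Q) (x : BasisState Q) (b : Fin 2) :
    g.fiber (Function.update x g.target b) = g.fiber x := by
  cases g with
  | CNOT c t h => simp [fiber, target, h]
  | _ => rfl

variable [Fintype Q]

theorem op_eq_fiberOp (g : Gate Q) : g.op = fiberOp g.target g.fiber := by
  cases g with
  | CNOT c t h => simp [op, controlled_eq_fiberOp, target, fiber]
  | _ => rfl

theorem commute_op {g g' : Gate Q} (h : Disjoint g.qubits g'.qubits) : Commute g.op g'.op := by
  rw [op_eq_fiberOp, op_eq_fiberOp]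
  rw [Finset.disjoint_left] at h
  exact commute_fiberOp (fun e => h g.target_mem_qubits (by rw [e]; exact g'.target_mem_qubits))
    (fiber_update_of_notMem fun h' => h h' g'.target_mem_qubits)
    (fiber_update_of_notMem (h g.target_mem_qubits))

end Gate

section Word

variable {Q : Type*} [Fintype Q] [DecidableEq Q]

/-- The operator of a sequence of gates; the first gate in time is the rightmost factor. -/
def wordOp (w : List (Gate Q)) : QOp Q := (w.reverse.map Gate.op).prod

@[simp] theorem wordOp_nil : wordOp ([] : List (Gate Q)) = 1 := by simp [wordOp]

theorem wordOp_append (w w' : List (Gate Q)) : wordOp (w ++ w') = wordOp w' * wordOp w := by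
  simp [wordOp]

theorem wordOp_cons (g : Gate Q) (w : List (Gate Q)) : wordOp (g :: w) = wordOp w * g.op := by
  simp [wordOp]

theorem commute_wordOp {w w' : List (Gate Q)}
    (h : ∀ g ∈ w, ∀ g' ∈ w', Disjoint g.qubits g'.qubits) : Commute (wordOp w) (wordOp w') := by
  induction w with
  | nil => simp
  | cons g w ih =>
    rw [wordOp_cons]
    refine (ih fun g hg => h g (List.mem_cons_of_mem _ hg)).mul_left ?_
    replace h := h g List.mem_cons_self
    clear ih
    induction w' with
    | nil => simp
    | cons g' w' ih =>
      rw [wordOp_cons]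
      exact (ih fun g hg => h g (List.mem_cons_of_mem _ hg)).mul_right
        (Gate.commute_op (h g' List.mem_cons_self))

/-- A sequence of gates with a common target is a conditioned operator on that target. -/
theorem wordOp_eq_fiberOp {q : Q} {w : List (Gate Q)} (h : ∀ g ∈ w, g.target = q) :
    wordOp w = fiberOp q fun x => (w.reverse.map fun g => g.fiber x).prod := by
  induction w using List.reverseRecOn with
  | nil => simp [fiberOp_one]
  | append_singleton w g ih =>
    have hg : g.target = q := h g (by simp)
    rw [wordOp_append, ih fun g hg => h g (by simp [hg]), wordOp_cons, wordOp_nil, one_mul,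
      Gate.op_eq_fiberOp, hg, fiberOp_mul]
    · simp
    · exact hg ▸ g.fiber_update_target

end Word

/-! ### Identities between single-qubit matrices -/

theorem matrix_fin_two_congr {a b c d a' b' c' d' : ℂ} (ha : a = a') (hb : b = b') (hc : c = c')
    (hd : d = d') : !![a, b; c, d] = !![a', b'; c', d'] := by
  rw [ha, hb, hc, hd]

/-- The eighth root of unity `e^{iπ/4}`. -/
def omega8 : ℂ := Complex.exp ((Real.pi / 4 : ℝ) * Complex.I)

theorem omega8_sq : omega8 * omega8 = Complex.I := by
  rw [omega8, ← Complex.exp_add]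
  refine Eq.trans (congrArg Complex.exp ?_) Complex.exp_pi_div_two_mul_I
  push_cast
  ring

theorem phase_quarter : phase (Real.pi / 4) = !![1, 0; 0, omega8] := rfl

theorem phase_neg_quarter : phase (-(Real.pi / 4)) = !![1, 0; 0, -Complex.I * omega8] := by
  have h1 : omega8 * Complex.exp ((-(Real.pi / 4) : ℝ) * Complex.I) = 1 := by
    rw [omega8, ← Complex.exp_add, ← add_mul]
    simp
  have h2 : Complex.exp ((-(Real.pi / 4) : ℝ) * Complex.I) = -Complex.I * omega8 := by
    linear_combination (Complex.I * Complex.exp ((-(Real.pi / 4) : ℝ) * Complex.I)) * omega8_sq -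
      Complex.I * omega8 * h1 +
      Complex.exp ((-(Real.pi / 4) : ℝ) * Complex.I) * Complex.I_sq
  rw [phase, h2]

theorem hadamard_eq : ∃ r : ℂ, r * r = 1 / 2 ∧ _root_.hadamard = !![r, r; r, -r] := by
  refine ⟨1 / (Real.sqrt 2 : ℂ), ?_, by rw [_root_.hadamard, neg_div]⟩
  rw [div_mul_div_comm, ← Complex.ofReal_mul, Real.mul_self_sqrt zero_le_two]
  norm_num

theorem hadamard_mul_self : _root_.hadamard * _root_.hadamard = 1 := by
  obtain ⟨r, hr, h⟩ := hadamard_eq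
  rw [h, Matrix.mul_fin_two, Matrix.one_fin_two]
  apply matrix_fin_two_congr <;> ring_nf <;> linear_combination 2 * hr

theorem pauliX_mul_self : pauliX * pauliX = 1 := by
  simp [pauliX, Matrix.one_fin_two]

theorem phase_mul (a b : ℝ) : phase a * phase b = phase (a + b) := by
  simp [phase, ← Complex.exp_add, add_mul]

theorem phase_zero : phase 0 = 1 := by
  simp [phase, Matrix.one_fin_two]

theorem rotX_mul (a b : ℝ) : rotX a * rotX b = rotX (a + b) := by
  simp only [rotX, Matrix.mul_fin_two, add_div, Real.cos_add, Real.sin_add]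
  push_cast
  apply matrix_fin_two_congr <;> ring_nf <;> simp only [Complex.I_sq] <;> ring

theorem rotX_zero : rotX 0 = 1 := by
  simp [rotX, Matrix.one_fin_two]

theorem rotZ_mul (a b : ℝ) : rotZ a * rotZ b = rotZ (a + b) := by
  simp only [rotZ, Matrix.mul_fin_two, mul_zero, zero_mul, add_zero, zero_add, ← Complex.exp_add]
  refine matrix_fin_two_congr (congrArg Complex.exp ?_) rfl rfl (congrArg Complex.exp ?_) <;>
  · push_cast
    ring

theorem rotZ_zero : rotZ 0 = 1 := by
  simp [rotZ, Matrix.one_fin_two]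

/-- The matrix `-iZ = diag(-i, i)` or, for the sign `false`, its inverse `iZ = diag(i, -i)`. -/
def iZ (s : Bool) : Matrix (Fin 2) (Fin 2) ℂ :=
  if s then !![-Complex.I, 0; 0, Complex.I] else !![Complex.I, 0; 0, -Complex.I]

theorem iZ_mul_rotX_mul (θ : ℝ) : iZ false * rotX θ * iZ true = rotX (-θ) := by
  simp only [iZ, rotX, Matrix.mul_fin_two, if_true, Bool.false_eq_true, if_false, neg_div,
    Real.cos_neg, Real.sin_neg]
  push_cast
  apply matrix_fin_two_congr <;> ring_nf <;> simp

theorem iZ_mul : iZ false * iZ true = 1 := by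
  simp [iZ, Matrix.one_fin_two]

/-- The gate `T` or, for the sign `false`, `T†` as a matrix. -/
def tMatrix (s : Bool) : Matrix (Fin 2) (Fin 2) ℂ :=
  phase (if s then Real.pi / 4 else -(Real.pi / 4))

theorem tMatrix_mul_not (s : Bool) : tMatrix s * tMatrix (!s) = 1 := by
  cases s <;> simp [tMatrix, phase_mul, phase_zero]

theorem tMatrix_not_mul (s : Bool) : tMatrix (!s) * tMatrix s = 1 := by
  cases s <;> simp [tMatrix, phase_mul, phase_zero]

theorem tMatrix_true : tMatrix true = !![1, 0; 0, omega8] := phase_quarter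

theorem tMatrix_false : tMatrix false = !![1, 0; 0, -Complex.I * omega8] := phase_neg_quarter

/-- What the core of a block applies to its target when its first control is in the state `1` and
the other one in the state `0`. -/
theorem tMatrix_conj_mul_conj (s : Bool) :
    tMatrix s * pauliX * tMatrix (!s) * (tMatrix (!s) * pauliX * tMatrix s) = iZ s := by
  cases s <;>
  simp only [iZ, tMatrix_true, tMatrix_false, pauliX, Matrix.mul_fin_two, Bool.not_true,
    Bool.not_false, if_true, Bool.false_eq_true, if_false] <;>
  apply matrix_fin_two_congr <;> ring_nf <;>
  simp only [Complex.I_sq, show omega8 ^ 2 = Complex.I by rw [sq, omega8_sq]] <;> ring_nf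

/-- Conjugation by `X` exchanges `T` and `T†` up to a scalar, which cancels here. For this reason
the core does nothing when both of its controls are in the state `1`. -/
theorem pauliX_mul_tMatrix_conj_mul (s : Bool) :
    pauliX * (tMatrix s * pauliX * tMatrix (!s)) * pauliX = tMatrix (!s) * pauliX * tMatrix s := by
  cases s <;>
  simp [tMatrix_true, tMatrix_false, pauliX]

/-- A matrix that maps each basis vector to a multiple of itself or, if `flip` holds, of the other
basis vector. -/
def MonomialMatrix (flip : Prop) (M : Matrix (Fin 2) (Fin 2) ℂ) : Prop :=
  (flip → M 0 0 = 0 ∧ M 1 1 = 0) ∧ (¬ flip → M 0 1 = 0 ∧ M 1 0 = 0)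

/-- The matrix which a rung applies to its target: `p` and `q` tell whether its qubits `ctrl` and
`prev` are in the state `1`, and `e` is the state of `prev` on which it is active. -/
def rungMatrix (e : Bool) (p q : Prop) [Decidable p] [Decidable q] : Matrix (Fin 2) (Fin 2) ℂ :=
  _root_.hadamard * (tMatrix (!e) * ((if p then pauliX else 1) * (tMatrix e *
    ((if q then pauliX else 1) * (tMatrix false * ((if p then pauliX else 1) *
      (tMatrix true * _root_.hadamard)))))))

/-- A rung flips its target, up to phases, if and only if it is active. For `e = true` the matrix is
`1`, `Z`, `1`, `Y` and for `e = false` it is `1`, `Z`, `-iX`, `Z` for the states `00`, `01`, `10`,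
`11` of `ctrl` and `prev`. -/
theorem rungMatrix_monomial (e : Bool) (p q : Prop) [Decidable p] [Decidable q] :
    MonomialMatrix (p ∧ (q ↔ e = true)) (rungMatrix e p q) := by
  obtain ⟨r, -, h⟩ := hadamard_eq
  have ho : omega8 ^ 2 = Complex.I := by rw [sq, omega8_sq]
  have ho4 : omega8 ^ 4 = -1 := by rw [show 4 = 2 * 2 by rfl, pow_mul, ho, Complex.I_sq]
  rw [MonomialMatrix, rungMatrix, h]
  by_cases hp : p <;> by_cases hq : q <;> cases e <;>
  simp [hp, hq, tMatrix_true, tMatrix_false, pauliX, Matrix.one_fin_two] <;>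
  ring_nf <;> simp [ho, ho4, Complex.I_sq]

/-- Polar coordinates. -/
theorem exists_polar (p q : ℝ) :
    ∃ α : ℝ, p = Real.sqrt (p ^ 2 + q ^ 2) * Real.cos α ∧
      q = Real.sqrt (p ^ 2 + q ^ 2) * Real.sin α := by
  refine ⟨Complex.arg ⟨p, q⟩, ?_, ?_⟩
  · have h := Complex.norm_mul_cos_arg ⟨p, q⟩
    rw [Complex.norm_eq_sqrt_sq_add_sq] at h
    exact h.symm
  · have h := Complex.norm_mul_sin_arg ⟨p, q⟩
    rw [Complex.norm_eq_sqrt_sq_add_sq] at h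
    exact h.symm

/-- The rotation axis of `R_x(a) R_z(b) R_x(l) R_z(-b) R_x(-a)` is the `x`-axis, rotated by `b`
about the `z`-axis and by `a` about the `x`-axis. -/
theorem rotX_mul_rotZ_conj (a b l : ℝ) :
    rotX a * rotZ b * rotX l * rotZ (-b) * rotX (-a) =
      !![(Real.cos (l / 2) : ℂ) - Complex.I * Real.sin (l / 2) * Real.sin b * Real.sin a,
        -Complex.I * Real.sin (l / 2) * Real.cos b -
          Real.sin (l / 2) * Real.sin b * Real.cos a;
        -Complex.I * Real.sin (l / 2) * Real.cos b +
          Real.sin (l / 2) * Real.sin b * Real.cos a,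
        (Real.cos (l / 2) : ℂ) + Complex.I * Real.sin (l / 2) * Real.sin b * Real.sin a] := by
  have hz : rotZ b * rotX l * rotZ (-b) =
      !![(Real.cos (l / 2) : ℂ), Real.sin (l / 2) * (-Complex.I * Real.cos b - Real.sin b);
        Real.sin (l / 2) * (-Complex.I * Real.cos b + Real.sin b), (Real.cos (l / 2) : ℂ)] := by
    have h1 : Complex.exp (-(b / 2 : ℝ) * Complex.I) * Complex.exp ((b / 2 : ℝ) * Complex.I) =
        1 := by
      rw [← Complex.exp_add]; simp
    have h2 : Complex.exp (-(b / 2 : ℝ) * Complex.I) * Complex.exp (-(b / 2 : ℝ) * Complex.I) =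
        Real.cos b - Real.sin b * Complex.I := by
      rw [← Complex.exp_add, ← add_mul, Complex.exp_mul_I, show
        -((b / 2 : ℝ) : ℂ) + -((b / 2 : ℝ) : ℂ) = -(b : ℂ) by push_cast; ring]
      simp; ring
    have h3 : Complex.exp ((b / 2 : ℝ) * Complex.I) * Complex.exp ((b / 2 : ℝ) * Complex.I) =
        Real.cos b + Real.sin b * Complex.I := by
      rw [← Complex.exp_add, ← add_mul, Complex.exp_mul_I, show
        ((b / 2 : ℝ) : ℂ) + ((b / 2 : ℝ) : ℂ) = (b : ℂ) by push_cast; ring]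
      simp
    simp only [rotZ, rotX, Matrix.mul_fin_two, neg_div, Complex.ofReal_neg, neg_neg]
    set u := Complex.exp (-(b / 2 : ℝ) * Complex.I)
    set v := Complex.exp ((b / 2 : ℝ) * Complex.I)
    apply matrix_fin_two_congr
    · linear_combination (Real.cos (l / 2) : ℂ) * h1
    · linear_combination (-Complex.I * Real.sin (l / 2)) * h2 +
        Real.sin (l / 2) * Real.sin b * Complex.I_sq
    · linear_combination (-Complex.I * Real.sin (l / 2)) * h3 -
        Real.sin (l / 2) * Real.sin b * Complex.I_sq
    · linear_combination (Real.cos (l / 2) : ℂ) * h1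
  have hc : (Real.cos a : ℂ) = Real.cos (a / 2) ^ 2 - Real.sin (a / 2) ^ 2 := by
    rw [show a = 2 * (a / 2) by ring, Real.cos_two_mul']; push_cast; simp
  have hs : (Real.sin a : ℂ) = 2 * Real.sin (a / 2) * Real.cos (a / 2) := by
    rw [show a = 2 * (a / 2) by ring, Real.sin_two_mul]; push_cast; simp
  have h1 : (Real.cos (a / 2) : ℂ) ^ 2 + (Real.sin (a / 2) : ℂ) ^ 2 = 1 := by
    exact_mod_cast Real.cos_sq_add_sin_sq (a / 2)
  rw [show rotX a * rotZ b * rotX l * rotZ (-b) * rotX (-a) =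
    rotX a * (rotZ b * rotX l * rotZ (-b)) * rotX (-a) by simp only [mul_assoc], hz, hc, hs]
  simp only [rotX, Matrix.mul_fin_two, neg_div, Real.cos_neg, Real.sin_neg, Complex.ofReal_neg]
  generalize (Real.cos (a / 2) : ℂ) = c at *
  generalize (Real.sin (a / 2) : ℂ) = s at *
  generalize (Real.cos (l / 2) : ℂ) = k
  generalize (Real.sin (l / 2) : ℂ) = w
  generalize (Real.cos b : ℂ) = y
  generalize (Real.sin b : ℂ) = z
  apply matrix_fin_two_congr
  · linear_combination k * h1 - k * s ^ 2 * Complex.I_sq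
  · linear_combination (-Complex.I * w * y) * h1 +
      (Complex.I * w * y - w * z) * s ^ 2 * Complex.I_sq
  · linear_combination (-Complex.I * w * y) * h1 +
      (Complex.I * w * y + w * z) * s ^ 2 * Complex.I_sq
  · linear_combination k * h1 - k * s ^ 2 * Complex.I_sq

/-- The rotation axis and the angle of `W` in spherical coordinates about the `x`-axis. -/
theorem exists_rotX_rotZ_conj (W : Matrix (Fin 2) (Fin 2) ℂ)
    (hW : W ∈ Matrix.specialUnitaryGroup (Fin 2) ℂ) :
    ∃ a b l : ℝ, W = rotX a * rotZ b * rotX l * rotZ (-b) * rotX (-a) := by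
  obtain ⟨hU, hdet⟩ := Matrix.mem_specialUnitaryGroup_iff.1 hW
  -- `W⁻¹` is the conjugate transpose and, as `det W = 1`, also the adjugate of `W`.
  have hadj : star W = W.adjugate := by
    have h1 : W * star W = 1 := Matrix.mem_unitaryGroup_iff.1 hU
    calc star W = (W.adjugate * W) * star W := by rw [Matrix.adjugate_mul, hdet, one_smul, one_mul]
      _ = W.adjugate := by rw [mul_assoc, h1, mul_one]
  rw [Matrix.adjugate_fin_two] at hadj
  have h11 : star (W 0 0) = W 1 1 := congr_fun (congr_fun hadj 0) 0
  have h10 : star (W 0 1) = -W 1 0 := congr_fun (congr_fun hadj 1) 0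
  rw [Matrix.det_fin_two, ← h11, ← neg_eq_iff_eq_neg.2 h10] at hdet
  obtain ⟨a, ha1, ha2⟩ := exists_polar (-(W 0 1).re) (-(W 0 0).im)
  set r := Real.sqrt ((-(W 0 1).re) ^ 2 + (-(W 0 0).im) ^ 2) with hr
  obtain ⟨b, hb1, hb2⟩ := exists_polar (-(W 0 1).im) r
  set s := Real.sqrt ((-(W 0 1).im) ^ 2 + r ^ 2) with hs
  obtain ⟨c, hc1, hc2⟩ := exists_polar (W 0 0).re s
  have h1 : (W 0 0).re ^ 2 + s ^ 2 = 1 := by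
    rw [hs, Real.sq_sqrt (by positivity), hr, Real.sq_sqrt (by positivity)]
    have := congrArg Complex.re hdet
    simp at this
    nlinarith
  rw [h1, Real.sqrt_one, one_mul] at hc1 hc2
  refine ⟨a, b, 2 * c, ?_⟩
  rw [rotX_mul_rotZ_conj, mul_div_cancel_left₀ _ (two_ne_zero' ℝ), ← hc1, ← hc2]
  have e1 : (s : ℂ) * Real.cos b = -(W 0 1).im := by rw [← Complex.ofReal_mul, ← hb1]; simp
  have e2 : (s : ℂ) * Real.sin b = r := by rw [← Complex.ofReal_mul, ← hb2]
  have e3 : (r : ℂ) * Real.cos a = -(W 0 1).re := by rw [← Complex.ofReal_mul, ← ha1]; simp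
  have e4 : (r : ℂ) * Real.sin a = -(W 0 0).im := by rw [← Complex.ofReal_mul, ← ha2]; simp
  have k0 := Complex.re_add_im (W 0 0)
  have k1 := Complex.re_add_im (W 0 1)
  have k0' : star (W 0 0) = (W 0 0).re - (W 0 0).im * Complex.I := by
    apply Complex.ext <;> simp
  have k1' : star (W 0 1) = (W 0 1).re - (W 0 1).im * Complex.I := by
    apply Complex.ext <;> simp
  refine (Matrix.eta_fin_two W).trans (matrix_fin_two_congr ?_ ?_ ?_ ?_)
  · linear_combination -k0 + Complex.I * Real.sin a * e2 + Complex.I * e4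
  · linear_combination -k1 + Complex.I * e1 + Real.cos a * e2 + e3
  · linear_combination h10 - k1' + Complex.I * e1 - Real.cos a * e2 - e3
  · linear_combination -h11 + k0' - Complex.I * Real.sin a * e2 - Complex.I * e4

/-! ### Inverses of words -/

section Inverse

variable {Q : Type*} [Fintype Q] [DecidableEq Q]

theorem Gate.op_inv_mul_op (g : Gate Q) : g.inv.op * g.op = 1 := by
  rw [g.inv.op_eq_fiberOp, g.op_eq_fiberOp, g.target_inv, fiberOp_mul]
  · convert fiberOp_one g.target using 2
    funext x
    cases g with
    | CNOT c t h =>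
      by_cases hx : x c = 1 <;> simp [Gate.inv, Gate.fiber, hx, pauliX_mul_self]
    | _ => simp [Gate.inv, Gate.fiber, hadamard_mul_self, phase_mul, phase_zero, rotX_mul,
        rotX_zero, rotZ_mul, rotZ_zero]
  · exact fun x b => g.target_inv ▸ g.inv.fiber_update_target x b

/-- The gates of a word inverted, in the opposite order. -/
def invWord {Q : Type*} (w : List (Gate Q)) : List (Gate Q) := (w.map Gate.inv).reverse

theorem wordOp_invWord_mul (w : List (Gate Q)) : wordOp (invWord w) * wordOp w = 1 := by
  induction w with
  | nil => simp [invWord]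
  | cons g w ih =>
    have : invWord (g :: w) = invWord w ++ [g.inv] := by simp [invWord]
    rw [this, wordOp_append, wordOp_cons g.inv, wordOp_nil, one_mul, wordOp_cons, mul_assoc,
      ← mul_assoc (wordOp (invWord w)), ih, one_mul, g.op_inv_mul_op]

end Inverse

/-! ### Operators that permute the basis states up to phases -/

section Monomial

variable {Q : Type*} [Fintype Q] [DecidableEq Q]

/-- `M` maps each basis vector `y` to a multiple of the basis vector `τ y`. The factors are left
open: they cancel in the conjugation of a diagonal operator. -/
def Sends (M : QOp Q) (τ : BasisState Q → BasisState Q) : Prop := ∀ x y, M x y ≠ 0 → x = τ y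

theorem sends_one {Q : Type*} [Fintype Q] : Sends (1 : QOp Q) id := fun x y h => by
  by_contra hne
  exact h (Matrix.one_apply_ne hne)

theorem Sends.mul {M N : QOp Q} {τ σ : BasisState Q → BasisState Q} (hM : Sends M τ)
    (hN : Sends N σ) : Sends (M * N) (τ ∘ σ) := fun x y h => by
  rw [Matrix.mul_apply] at h
  obtain ⟨z, -, hz⟩ := Finset.exists_ne_zero_of_sum_ne_zero h
  rw [hM x z (left_ne_zero_of_mul hz), hN z y (right_ne_zero_of_mul hz), Function.comp]

theorem Sends.diagonal_mul {M : QOp Q} {τ : BasisState Q → BasisState Q} (hM : Sends M τ)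
    (d : BasisState Q → ℂ) : diagonal d * M = M * diagonal (d ∘ τ) := by
  ext x y
  rw [Matrix.diagonal_mul, Matrix.mul_diagonal, mul_comm]
  by_cases h : M x y = 0
  · rw [h, zero_mul, zero_mul]
  · rw [hM x y h, Function.comp]

theorem sends_fiberOp (t : Q) {F : BasisState Q → Matrix (Fin 2) (Fin 2) ℂ}
    {flip : BasisState Q → Prop} [DecidablePred flip] (h : ∀ x, MonomialMatrix (flip x) (F x)) :
    Sends (fiberOp t F) fun x => if flip x then Function.update x t (x t + 1) else x := by
  intro x y hxy
  rw [fiberOp] at hxy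
  obtain ⟨h1, h2⟩ : (∀ q, q ≠ t → x q = y q) ∧ F y (x t) (y t) ≠ 0 := by
    split_ifs at hxy with h1
    · exact ⟨h1, hxy⟩
    · exact absurd rfl hxy
  rw [agree_off_iff.1 h1]
  by_cases hf : flip y
  · simp only [if_pos hf]
    congr 1
    obtain ⟨h00, h11⟩ := (h y).1 hf
    generalize x t = i at h2 ⊢
    generalize y t = j at h2 ⊢
    fin_cases i <;> fin_cases j <;> simp_all
  · simp only [if_neg hf]
    obtain ⟨h01, h10⟩ := (h y).2 hf
    have : x t = y t := by
      generalize x t = i at h2 ⊢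
      generalize y t = j at h2 ⊢
      fin_cases i <;> fin_cases j <;> simp_all
    rw [this, Function.update_eq_self]

end Monomial

/-! ### Ladders of relative-phase Toffoli gates -/

/-- `T` or, for the sign `false`, `T†`. -/
def Gate.tGate {Q : Type*} (s : Bool) (q : Q) : Gate Q := if s then Gate.T q else Gate.Tdg q

/-- A rung of a ladder: a Toffoli gate up to relative phases. It flips `target` if `ctrl` is in the
state `1` and `prev`, the target of the next rung as a rule, is in the state `active`. -/
structure Rung (Q : Type*) where
  target : Q
  ctrl : Q
  prev : Q
  active : Bool
  ctrl_ne : ctrl ≠ target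
  prev_ne : prev ≠ target

namespace Rung

variable {Q : Type*}

/-- The first gates of a rung; they do not involve its qubit `prev`. -/
def opening (r : Rung Q) : List (Gate Q) :=
  [.H r.target, .T r.target, .CNOT r.ctrl r.target r.ctrl_ne, .Tdg r.target]

/-- The last gates of a rung. -/
def closing (r : Rung Q) : List (Gate Q) :=
  [.CNOT r.prev r.target r.prev_ne, .tGate r.active r.target, .CNOT r.ctrl r.target r.ctrl_ne,
    .tGate (!r.active) r.target, .H r.target]

variable [DecidableEq Q]

/-- The qubits on which a rung acts. -/
def qubits (r : Rung Q) : Finset Q := {r.target, r.ctrl, r.prev}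

/-- The rung `r` does not disturb the rung `r'`, and does not share its control with it. -/
def Indep (r r' : Rung Q) : Prop := r.target ∉ r'.qubits ∧ r.ctrl ∉ r'.qubits

/-- The action of a rung on the basis states. -/
def act (r : Rung Q) (x : BasisState Q) : BasisState Q :=
  if x r.ctrl = 1 ∧ (x r.prev = 1 ↔ r.active = true) then
    Function.update x r.target (x r.target + 1) else x

variable [Fintype Q]

theorem sends_act (r : Rung Q) : Sends (wordOp (r.opening ++ r.closing)) r.act := by
  have h : wordOp (r.opening ++ r.closing) =
      fiberOp r.target fun x => rungMatrix r.active (x r.ctrl = 1) (x r.prev = 1) := by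
    rw [wordOp_eq_fiberOp (q := r.target)]
    · cases h : r.active <;>
      simp [opening, closing, Gate.fiber, rungMatrix, Gate.tGate, tMatrix, h]
    · cases h : r.active <;> simp [opening, closing, Gate.target, Gate.tGate, h]
  rw [h]
  exact sends_fiberOp _ fun x => rungMatrix_monomial _ _ _

end Rung

section Ladder

variable {Q : Type*}

/-- The first of the four layers which open all rungs of a ladder at the same time. -/
def hGates (rs : List (Rung Q)) : List (Gate Q) := rs.map fun r => .H r.target

/-- The second opening layer of a ladder. -/
def tGates (rs : List (Rung Q)) : List (Gate Q) := rs.map fun r => .T r.target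

/-- The third opening layer of a ladder. -/
def cnotGates (rs : List (Rung Q)) : List (Gate Q) :=
  rs.map fun r => .CNOT r.ctrl r.target r.ctrl_ne

/-- The fourth opening layer of a ladder. -/
def tdgGates (rs : List (Rung Q)) : List (Gate Q) := rs.map fun r => .Tdg r.target

/-- The gates that close all rungs of a ladder, from the last rung to the first one. -/
def closing : List (Rung Q) → List (Gate Q)
  | [] => []
  | r :: rs => closing rs ++ r.closing

variable [DecidableEq Q]

/-- The action of a ladder on the basis states; the last rung acts first. -/
def ladderAct : List (Rung Q) → BasisState Q → BasisState Q
  | [] => id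
  | r :: rs => r.act ∘ ladderAct rs

theorem qubits_hGates {rs : List (Rung Q)} {g : Gate Q} (hg : g ∈ hGates rs) :
    ∃ r ∈ rs, g.qubits ⊆ {r.target, r.ctrl} := by
  obtain ⟨r, hr, rfl⟩ := List.mem_map.1 hg
  exact ⟨r, hr, by simp [Gate.qubits]⟩

theorem qubits_tGates {rs : List (Rung Q)} {g : Gate Q} (hg : g ∈ tGates rs) :
    ∃ r ∈ rs, g.qubits ⊆ {r.target, r.ctrl} := by
  obtain ⟨r, hr, rfl⟩ := List.mem_map.1 hg
  exact ⟨r, hr, by simp [Gate.qubits]⟩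

theorem qubits_cnotGates {rs : List (Rung Q)} {g : Gate Q} (hg : g ∈ cnotGates rs) :
    ∃ r ∈ rs, g.qubits ⊆ {r.target, r.ctrl} := by
  obtain ⟨r, hr, rfl⟩ := List.mem_map.1 hg
  exact ⟨r, hr, by simp [Gate.qubits, Finset.pair_comm]⟩

theorem qubits_tdgGates {rs : List (Rung Q)} {g : Gate Q} (hg : g ∈ tdgGates rs) :
    ∃ r ∈ rs, g.qubits ⊆ {r.target, r.ctrl} := by
  obtain ⟨r, hr, rfl⟩ := List.mem_map.1 hg
  exact ⟨r, hr, by simp [Gate.qubits]⟩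

theorem qubits_rung_opening {r : Rung Q} {g : Gate Q} (hg : g ∈ r.opening) :
    g.qubits ⊆ {r.target, r.ctrl} := by
  simp only [Rung.opening, List.mem_cons, List.not_mem_nil, or_false] at hg
  rcases hg with rfl | rfl | rfl | rfl <;> simp [Gate.qubits, Finset.pair_comm]

theorem qubits_tGate (s : Bool) (q : Q) : (Gate.tGate s q).qubits = {q} := by
  cases s <;> rfl

theorem qubits_rung_closing {r : Rung Q} {g : Gate Q} (hg : g ∈ r.closing) :
    g.qubits ⊆ r.qubits := by
  simp only [Rung.closing, List.mem_cons, List.not_mem_nil, or_false] at hg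
  rcases hg with rfl | rfl | rfl | rfl | rfl <;>
  (try simp only [qubits_tGate]) <;> simp [Gate.qubits, Rung.qubits, Finset.insert_subset_iff]

theorem qubits_closing {rs : List (Rung Q)} {g : Gate Q} (hg : g ∈ closing rs) :
    ∃ r ∈ rs, g.qubits ⊆ r.qubits := by
  induction rs with
  | nil => simp [closing] at hg
  | cons r rs ih =>
    rcases List.mem_append.1 hg with hg | hg
    · obtain ⟨r', hr', h⟩ := ih hg
      exact ⟨r', List.mem_cons_of_mem _ hr', h⟩
    · exact ⟨r, List.mem_cons_self, qubits_rung_closing hg⟩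

theorem Rung.pair_subset_qubits (r : Rung Q) : {r.target, r.ctrl} ⊆ r.qubits := by
  simp [Rung.qubits, Finset.insert_subset_iff]

/-- The gates that open all rungs of a ladder, layer by layer. -/
def opening (rs : List (Rung Q)) : List (Gate Q) :=
  hGates rs ++ tGates rs ++ cnotGates rs ++ tdgGates rs

theorem qubits_ladder {rs : List (Rung Q)} {g : Gate Q} (hg : g ∈ opening rs ++ closing rs) :
    ∃ r ∈ rs, g.qubits ⊆ r.qubits := by
  simp only [opening, List.mem_append] at hg
  rcases hg with (((hg | hg) | hg) | hg) | hg
  · exact (qubits_hGates hg).imp fun r h => ⟨h.1, h.2.trans r.pair_subset_qubits⟩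
  · exact (qubits_tGates hg).imp fun r h => ⟨h.1, h.2.trans r.pair_subset_qubits⟩
  · exact (qubits_cnotGates hg).imp fun r h => ⟨h.1, h.2.trans r.pair_subset_qubits⟩
  · exact (qubits_tdgGates hg).imp fun r h => ⟨h.1, h.2.trans r.pair_subset_qubits⟩
  · exact qubits_closing hg

variable [Fintype Q]

/-- Gates that are prepended to the four opening layers can be executed before them if they act on
other qubits. -/
theorem wordOp_opening_cons {S : Finset Q} {h : List (Gate Q)} {t c d : Gate Q}
    {rs : List (Rung Q)} (ht : t.qubits ⊆ S) (hc : c.qubits ⊆ S) (hd : d.qubits ⊆ S)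
    (hS : ∀ r ∈ rs, Disjoint S r.qubits) :
    wordOp (h ++ hGates rs ++ t :: tGates rs ++ c :: cnotGates rs ++ d :: tdgGates rs) =
      wordOp (opening rs) * wordOp (h ++ [t, c, d]) := by
  have key : ∀ {g : Gate Q} {w : List (Gate Q)}, g.qubits ⊆ S →
      (∀ g' ∈ w, ∃ r ∈ rs, g'.qubits ⊆ {r.target, r.ctrl}) → g.op * wordOp w = wordOp w * g.op := by
    intro g w hg hw
    have : Commute (wordOp [g]) (wordOp w) := commute_wordOp fun g₁ h₁ g₂ h₂ => by
      obtain ⟨r, hr, h⟩ := hw g₂ h₂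
      rw [List.mem_singleton.1 h₁]
      exact (hS r hr).mono hg (h.trans r.pair_subset_qubits)
    rwa [wordOp_cons, wordOp_nil, one_mul] at this
  have t1 := key (w := hGates rs) ht fun _ => qubits_hGates
  have c1 := key (w := hGates rs) hc fun _ => qubits_hGates
  have c2 := key (w := tGates rs) hc fun _ => qubits_tGates
  have d1 := key (w := hGates rs) hd fun _ => qubits_hGates
  have d2 := key (w := tGates rs) hd fun _ => qubits_tGates
  have d3 := key (w := cnotGates rs) hd fun _ => qubits_cnotGates
  simp only [opening, wordOp_append, wordOp_cons, wordOp_nil, one_mul, mul_assoc]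
  rw [← mul_assoc t.op, t1]
  simp only [mul_assoc]
  rw [← mul_assoc c.op, c2, mul_assoc, ← mul_assoc c.op, c1, mul_assoc, ← mul_assoc d.op, d3,
    mul_assoc, ← mul_assoc d.op, d2, mul_assoc, ← mul_assoc d.op, d1, mul_assoc]

/-- The opening gates of a rung act on qubits which the rungs after it in the list do not touch. So
they commute with these rungs, and the ladder acts as if its rungs were executed one after the
other, the last one first. -/
theorem sends_ladder {rs : List (Rung Q)} (hrs : rs.Pairwise Rung.Indep) :
    Sends (wordOp (opening rs ++ closing rs)) (ladderAct rs) := by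
  induction rs with
  | nil => simpa [opening, hGates, tGates, cnotGates, tdgGates, closing, ladderAct] using sends_one
  | cons r rs ih =>
    obtain ⟨hr, hrs⟩ := List.pairwise_cons.1 hrs
    have hS : ∀ r' ∈ rs, Disjoint {r.target, r.ctrl} r'.qubits := fun r' h' => by
      simpa [Rung.Indep] using hr r' h'
    have h1 : wordOp (opening (r :: rs)) = wordOp (opening rs) * wordOp r.opening :=
      wordOp_opening_cons (h := [.H r.target]) (t := .T r.target)
        (c := .CNOT r.ctrl r.target r.ctrl_ne) (d := .Tdg r.target) (S := {r.target, r.ctrl})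
        (by simp [Gate.qubits]) (by simp [Gate.qubits, Finset.pair_comm]) (by simp [Gate.qubits]) hS
    have h2 : Commute (wordOp (opening rs ++ closing rs)) (wordOp r.opening) :=
      commute_wordOp fun g hg g' hg' => by
        obtain ⟨r', hr', h⟩ := qubits_ladder hg
        exact ((hS r' hr').mono (qubits_rung_opening hg') h).symm
    have h3 : wordOp (opening (r :: rs) ++ closing (r :: rs)) =
        wordOp (r.opening ++ r.closing) * wordOp (opening rs ++ closing rs) := by
      rw [wordOp_append, h1, closing, wordOp_append, wordOp_append r.opening, mul_assoc,
        mul_assoc, ← h2.eq, wordOp_append]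
      simp only [mul_assoc]
    rw [h3]
    exact r.sends_act.mul (ih hrs)

end Ladder

/-! ### Blocks -/

section BlockWord

variable {Q : Type*} [DecidableEq Q]

/-- The data of a block on the target `t`: its core is controlled by `ctrl` and, on the state `0`,
by `anc`, a qubit whose value is prepared by a ladder. -/
structure Block (t : Q) where
  ctrl : Q
  anc : Q
  rungs : List (Rung Q)
  ctrl_ne : ctrl ≠ t
  anc_ne : anc ≠ t
  rungs_ne : rungs ≠ []
  indep : rungs.Pairwise Rung.Indep
  disjoint : ∀ r ∈ rungs, Disjoint {t, ctrl} r.qubits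

namespace Block

variable {t : Q}

/-- The part of the core of a block which does not involve `anc`. -/
def coreFirst (B : Block t) (s : Bool) : List (Gate Q) :=
  [.tGate s t, .CNOT B.ctrl t B.ctrl_ne, .tGate (!s) t]

/-- The other part of the core. Together both parts apply `iZ s` to the target if `ctrl` is in the
state `1` and `anc` in the state `0`. -/
def coreSecond (B : Block t) (s : Bool) : List (Gate Q) :=
  [.CNOT B.anc t B.anc_ne, .tGate (!s) t, .CNOT B.ctrl t B.ctrl_ne, .tGate s t,
    .CNOT B.anc t B.anc_ne]

/-- The gates of a block without its first and last layers of Hadamard gates. The first part of the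
core is executed together with the opening of the ladder. -/
def bodyWord (B : Block t) (s : Bool) : List (Gate Q) :=
  .tGate s t :: tGates B.rungs ++ .CNOT B.ctrl t B.ctrl_ne :: cnotGates B.rungs ++
    .tGate (!s) t :: tdgGates B.rungs ++
    (closing B.rungs ++ B.coreSecond s ++ invWord (closing B.rungs)) ++
    (invWord (tdgGates B.rungs) ++ invWord (cnotGates B.rungs) ++ invWord (tGates B.rungs))

/-- The gates of a block: the ladder, the core, the inverse of the ladder. -/
def word (B : Block t) (s : Bool) : List (Gate Q) :=
  hGates B.rungs ++ B.bodyWord s ++ invWord (hGates B.rungs)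

/-- The condition under which a block acts on its target. -/
def Active (B : Block t) (x : BasisState Q) : Prop := x B.ctrl = 1 ∧ ladderAct B.rungs x B.anc ≠ 1

instance (B : Block t) : DecidablePred B.Active := fun x => by unfold Active; infer_instance

end Block

theorem Rung.act_apply_of_ne {r : Rung Q} {q : Q} (h : q ≠ r.target) (x : BasisState Q) :
    r.act x q = x q := by
  rw [Rung.act]
  split_ifs
  · exact Function.update_of_ne h _ _
  · rfl

theorem ladderAct_apply_of_notMem {rs : List (Rung Q)} {q : Q} (h : ∀ r ∈ rs, q ∉ r.qubits)
    (x : BasisState Q) : ladderAct rs x q = x q := by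
  induction rs with
  | nil => rfl
  | cons r rs ih =>
    rw [ladderAct, Function.comp, Rung.act_apply_of_ne,
      ih fun r hr => h r (List.mem_cons_of_mem _ hr)]
    exact fun e => h r List.mem_cons_self (by simp [Rung.qubits, e])

theorem Rung.act_update {r : Rung Q} {q : Q} (h : q ∉ r.qubits) (x : BasisState Q) (b : Fin 2) :
    r.act (Function.update x q b) = Function.update (r.act x) q b := by
  simp only [Rung.qubits, Finset.mem_insert, Finset.mem_singleton, not_or] at h
  obtain ⟨h1, h2, h3⟩ := h
  simp only [Rung.act, Function.update_of_ne (Ne.symm h1), Function.update_of_ne (Ne.symm h2),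
    Function.update_of_ne (Ne.symm h3)]
  split_ifs
  · exact Function.update_comm h1 _ _ _
  · rfl

theorem ladderAct_update {rs : List (Rung Q)} {q : Q} (h : ∀ r ∈ rs, q ∉ r.qubits)
    (x : BasisState Q) (b : Fin 2) :
    ladderAct rs (Function.update x q b) = Function.update (ladderAct rs x) q b := by
  induction rs with
  | nil => rfl
  | cons r rs ih =>
    rw [ladderAct, Function.comp, ih fun r hr => h r (List.mem_cons_of_mem _ hr),
      Rung.act_update (h r List.mem_cons_self), Function.comp]

theorem invWord_append {Q : Type*} (w w' : List (Gate Q)) :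
    invWord (w ++ w') = invWord w' ++ invWord w := by
  simp [invWord]

namespace Block

variable {t : Q} (B : Block t)

theorem notMem_left {r : Rung Q} (hr : r ∈ B.rungs) : t ∉ r.qubits :=
  Finset.disjoint_left.1 (B.disjoint r hr) (by simp)

theorem notMem_right {r : Rung Q} (hr : r ∈ B.rungs) : B.ctrl ∉ r.qubits :=
  Finset.disjoint_left.1 (B.disjoint r hr) (by simp)

theorem active_update (x : BasisState Q) (b : Fin 2) :
    B.Active (Function.update x t b) ↔ B.Active x := by
  rw [Active, Active, ladderAct_update fun _ => B.notMem_left, Function.update_of_ne B.ctrl_ne,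
    Function.update_of_ne B.anc_ne]

variable [Fintype Q]

theorem wordOp_core (s : Bool) : wordOp (B.coreFirst s ++ B.coreSecond s) =
    fiberOp t fun x => if x B.ctrl = 1 ∧ x B.anc ≠ 1 then iZ s else 1 := by
  rw [wordOp_eq_fiberOp (q := t)]
  · congr 1
    funext x
    have hT : ∀ e q, (Gate.tGate e q).fiber x = tMatrix e := fun e q => by cases e <;> rfl
    have hC : ∀ c q h, (Gate.CNOT c q h).fiber x = if x c = 1 then pauliX else 1 :=
      fun _ _ _ => rfl
    have h : ((B.coreFirst s ++ B.coreSecond s).reverse.map fun g => g.fiber x).prod =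
        (if x B.anc = 1 then pauliX else 1) *
          (tMatrix s * (if x B.ctrl = 1 then pauliX else 1) * tMatrix (!s)) *
          (if x B.anc = 1 then pauliX else 1) *
          (tMatrix (!s) * (if x B.ctrl = 1 then pauliX else 1) * tMatrix s) := by
      simp [coreFirst, coreSecond, hT, hC, mul_assoc]
    rw [h]
    by_cases hc : x B.ctrl = 1 <;> by_cases ha : x B.anc = 1
    · simp only [hc, ha, if_true, ne_eq, not_true_eq_false, and_false, if_false,
        pauliX_mul_tMatrix_conj_mul]
      rw [mul_assoc, mul_assoc, ← mul_assoc (tMatrix s), ← mul_assoc (tMatrix s), tMatrix_mul_not,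
        one_mul, ← mul_assoc pauliX, pauliX_mul_self, one_mul, tMatrix_not_mul]
    · simp [hc, ha, tMatrix_conj_mul_conj]
    · simp [hc, ha, tMatrix_mul_not, tMatrix_not_mul, pauliX_mul_self]
    · simp [hc, ha, tMatrix_mul_not, tMatrix_not_mul]
  · cases s <;> simp [coreFirst, coreSecond, Gate.target, Gate.tGate]

/-- The ladder conjugates the diagonal operator of the core into one for which the bit of `anc` is
replaced by the value that the ladder computes. -/
theorem wordOp_word (s : Bool) :
    wordOp (B.word s) = fiberOp t fun x => if B.Active x then iZ s else 1 := by
  have hd : ∀ (P : BasisState Q → Prop) [DecidablePred P] (x : BasisState Q) (i j : Fin 2), i ≠ j →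
      (if P x then iZ s else 1) i j = 0 := fun P _ x i j hij => by
    split_ifs
    · cases s <;> fin_cases i <;> fin_cases j <;> simp_all [iZ]
    · exact Matrix.one_apply_ne hij
  have hopen : wordOp (hGates B.rungs ++ .tGate s t :: tGates B.rungs ++
      .CNOT B.ctrl t B.ctrl_ne :: cnotGates B.rungs ++ .tGate (!s) t :: tdgGates B.rungs) =
      wordOp (opening B.rungs) * wordOp (B.coreFirst s) :=
    wordOp_opening_cons (h := []) (S := {t, B.ctrl}) (by simp [qubits_tGate])
      (by simp [Gate.qubits, Finset.pair_comm]) (by simp [qubits_tGate]) B.disjoint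
  have hcomm : Commute (wordOp (opening B.rungs ++ closing B.rungs)) (wordOp (B.coreFirst s)) :=
    commute_wordOp fun g hg g' hg' => by
      obtain ⟨r, hr, h⟩ := qubits_ladder hg
      refine ((B.disjoint r hr).mono ?_ h).symm
      simp only [coreFirst, List.mem_cons, List.not_mem_nil, or_false] at hg'
      rcases hg' with rfl | rfl | rfl <;> (try simp only [qubits_tGate]) <;>
      simp [Gate.qubits, Finset.pair_comm]
  have hword : wordOp (B.word s) = wordOp (invWord (opening B.rungs ++ closing B.rungs)) *
      (wordOp (B.coreFirst s ++ B.coreSecond s) * wordOp (opening B.rungs ++ closing B.rungs)) := by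
    have : B.word s = (hGates B.rungs ++ .tGate s t :: tGates B.rungs ++
        .CNOT B.ctrl t B.ctrl_ne :: cnotGates B.rungs ++ .tGate (!s) t :: tdgGates B.rungs) ++
        closing B.rungs ++ (B.coreSecond s ++ invWord (opening B.rungs ++ closing B.rungs)) := by
      simp only [word, bodyWord, opening, invWord_append, List.append_assoc, List.cons_append]
    rw [this, wordOp_append, wordOp_append, wordOp_append _ (closing _), hopen,
      wordOp_append (B.coreFirst s), mul_assoc, mul_assoc, ← hcomm.eq, wordOp_append (opening _)]
    simp only [mul_assoc]
  rw [hword, wordOp_core, fiberOp_eq_diagonal _ (hd _), (sends_ladder B.indep).diagonal_mul,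
    ← mul_assoc, wordOp_invWord_mul, one_mul, fiberOp_eq_diagonal _ (hd _)]
  congr 1
  funext x
  simp only [Function.comp, Active, ladderAct_apply_of_notMem fun _ => B.notMem_left,
    ladderAct_apply_of_notMem fun _ => B.notMem_right]

end Block

end BlockWord

/-! ### Circuits built from layers -/

section Layers

variable {Q : Type*} [DecidableEq Q]

/-- The layer that holds one gate only. -/
def Layer.single (g : Gate Q) : Layer Q := ⟨[g], List.pairwise_singleton _ _⟩

/-- The gates of a word, executed one after the other. -/
def serial (w : List (Gate Q)) : Circuit Q := w.map Layer.single

theorem pairwise_disjoint_invWord {w : List (Gate Q)}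
    (h : w.Pairwise fun g g' => Disjoint g.qubits g'.qubits) :
    (invWord w).Pairwise fun g g' => Disjoint g.qubits g'.qubits := by
  rw [invWord, List.pairwise_reverse, List.pairwise_map]
  simpa only [Gate.qubits_inv, disjoint_comm] using h

/-- The layer of the inverse gates. -/
def Layer.inv (L : Layer Q) : Layer Q := ⟨invWord L.gates, pairwise_disjoint_invWord L.disjoint⟩

/-- A gate before a layer of gates on other qubits: in the same layer if `m` holds, and in a layer
of its own otherwise. -/
def mergeLayer (m : Bool) (g : Gate Q) (L : Layer Q)
    (h : ∀ g' ∈ L.gates, Disjoint g.qubits g'.qubits) : Circuit Q :=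
  if m then [⟨g :: L.gates, List.pairwise_cons.2 ⟨h, L.disjoint⟩⟩] else [Layer.single g, L]

namespace Circuit

theorem gates_append (c d : Circuit Q) : gates (c ++ d) = gates c ++ gates d :=
  List.flatMap_append

theorem gates_cons (L : Layer Q) (c : Circuit Q) : gates (L :: c) = L.gates ++ gates c :=
  List.flatMap_cons

theorem gates_nil : gates ([] : Circuit Q) = [] := rfl

theorem gates_serial (w : List (Gate Q)) : gates (serial w) = w := by
  induction w with
  | nil => rfl
  | cons g w ih => rw [serial, List.map_cons, gates_cons, ← serial, ih]; rfl

theorem gates_mergeLayer (m : Bool) (g : Gate Q) (L : Layer Q)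
    (h : ∀ g' ∈ L.gates, Disjoint g.qubits g'.qubits) :
    gates (mergeLayer m g L h) = g :: L.gates := by
  cases m <;> simp [mergeLayer, gates, Layer.single]

theorem depth_append (p : Gate Q → Bool) (c d : Circuit Q) :
    depth p (c ++ d) = depth p c + depth p d :=
  List.countP_append

theorem depth_cons (p : Gate Q → Bool) (L : Layer Q) (c : Circuit Q) :
    depth p (L :: c) = (L.gates.any p).toNat + depth p c := by
  rw [depth, List.countP_cons, add_comm, ← depth]
  cases L.gates.any p <;> rfl

theorem depth_nil (p : Gate Q → Bool) : depth p ([] : Circuit Q) = 0 := rfl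

theorem depth_serial (p : Gate Q → Bool) (w : List (Gate Q)) : depth p (serial w) = w.countP p := by
  rw [depth, serial, List.countP_map]
  congr 1
  funext g
  simp [Layer.single]

theorem depth_mergeLayer (p : Gate Q → Bool) (m : Bool) (g : Gate Q) (L : Layer Q)
    (h : ∀ g' ∈ L.gates, Disjoint g.qubits g'.qubits) :
    depth p (mergeLayer m g L h) =
      if m then (p g || L.gates.any p).toNat else (p g).toNat + (L.gates.any p).toNat := by
  cases m <;> simp [mergeLayer, depth_cons, depth_nil, Layer.single]

end Circuit

end Layers

/-! ### Kinds of gates and their numbers -/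

section Kinds

theorem countP_map_const {α β : Type*} {f : α → β} {p : β → Bool} {b : Bool}
    (h : ∀ a, p (f a) = b) (l : List α) : (l.map f).countP p = b.toNat * l.length := by
  rw [List.countP_map, show p ∘ f = fun _ => b from funext h]
  cases b <;> simp

theorem any_map_const {α β : Type*} {f : α → β} {p : β → Bool} {b : Bool}
    (h : ∀ a, p (f a) = b) {l : List α} (hl : l ≠ []) : (l.map f).any p = b := by
  obtain ⟨a, l, rfl⟩ := List.exists_cons_of_ne_nil hl
  rw [List.any_map, show p ∘ f = fun _ => b from funext h]
  cases b <;> simp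

variable {Q : Type*}

/-- `p` is the kind of gates which contains the Hadamard gates, the gates `T` and `T†`, the CNOT
gates and the rotations according to `h`, `e`, `c` and `r`. -/
structure IsKind (p : Gate Q → Bool) (h e c r : Bool) : Prop where
  map_H : ∀ q, p (.H q) = h
  map_T : ∀ q, p (.T q) = e
  map_Tdg : ∀ q, p (.Tdg q) = e
  map_CNOT : ∀ q q' hne, p (.CNOT q q' hne) = c
  map_Rx : ∀ θ q, p (.Rx θ q) = r
  map_Rz : ∀ θ q, p (.Rz θ q) = r

theorem isKind_isH : IsKind (Q := Q) Gate.isH true false false false := by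
  constructor <;> intros <;> rfl

theorem isKind_isT : IsKind (Q := Q) Gate.isT false true false false := by
  constructor <;> intros <;> rfl

theorem isKind_isCNOT : IsKind (Q := Q) Gate.isCNOT false false true false := by
  constructor <;> intros <;> rfl

theorem isKind_isRotation : IsKind (Q := Q) Gate.isRotation false false false true := by
  constructor <;> intros <;> rfl

namespace IsKind

variable {p : Gate Q → Bool} {h e c r : Bool}

theorem map_inv (hp : IsKind p h e c r) (g : Gate Q) : p g.inv = p g := by
  cases g <;> simp [Gate.inv, hp.map_H, hp.map_T, hp.map_Tdg, hp.map_CNOT, hp.map_Rx, hp.map_Rz]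

theorem map_tGate (hp : IsKind p h e c r) (s : Bool) (q : Q) : p (.tGate s q) = e := by
  cases s
  · exact hp.map_Tdg q
  · exact hp.map_T q

theorem countP_invWord (hp : IsKind p h e c r) (w : List (Gate Q)) :
    (invWord w).countP p = w.countP p := by
  rw [invWord, List.countP_reverse, List.countP_map]
  congr 1
  exact funext hp.map_inv

theorem any_invWord (hp : IsKind p h e c r) (w : List (Gate Q)) :
    (invWord w).any p = w.any p := by
  rw [invWord, List.any_reverse, List.any_map]
  congr 1
  exact funext hp.map_inv

theorem countP_closing (hp : IsKind p h e c r) (rs : List (Rung Q)) :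
    (closing rs).countP p = (2 * c.toNat + 2 * e.toNat + h.toNat) * rs.length := by
  induction rs with
  | nil => simp [closing]
  | cons r rs ih =>
    rw [closing, List.countP_append, ih]
    simp only [Rung.closing, List.countP_cons, List.countP_nil, hp.map_CNOT, hp.map_tGate, hp.map_H,
      List.length_cons]
    cases h <;> cases e <;> cases c <;> simp <;> ring

theorem countP_coreSecond [DecidableEq Q] (hp : IsKind p h e c r) {t : Q} (B : Block t) (s : Bool) :
    (B.coreSecond s).countP p = 3 * c.toNat + 2 * e.toNat := by
  simp only [Block.coreSecond, List.countP_cons, List.countP_nil, hp.map_CNOT, hp.map_tGate]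
  cases e <;> cases c <;> simp

end IsKind

end Kinds

/-! ### The layers of a block -/

section MainCircuit

variable {Q : Type*} [DecidableEq Q] {t : Q}

theorem Rung.Indep.target_ne {r r' : Rung Q} (h : r.Indep r') : r.target ≠ r'.target :=
  fun e => h.1 (by simp [Rung.qubits, e])

theorem Rung.Indep.disjoint {r r' : Rung Q} (h : r.Indep r') :
    Disjoint {r.ctrl, r.target} ({r'.ctrl, r'.target} : Finset Q) := by
  obtain ⟨h1, h2⟩ := h
  simp only [Rung.qubits, Finset.mem_insert, Finset.mem_singleton, not_or] at h1 h2
  simpa using ⟨⟨Ne.symm h2.2.1, Ne.symm h1.2.1⟩, Ne.symm h2.1, Ne.symm h1.1⟩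

namespace Block

variable (B : Block t)

/-- The first layer of a block. -/
def hLayer : Layer Q where
  gates := hGates B.rungs
  disjoint := by
    rw [hGates, List.pairwise_map]
    exact B.indep.imp fun h => by simpa [Gate.qubits] using h.target_ne

/-- The layer of the gates `T` which open the ladder. -/
def tLayer : Layer Q where
  gates := tGates B.rungs
  disjoint := by
    rw [tGates, List.pairwise_map]
    exact B.indep.imp fun h => by simpa [Gate.qubits] using h.target_ne

/-- The layer of the gates `T†` which open the ladder. -/
def tdgLayer : Layer Q where
  gates := tdgGates B.rungs
  disjoint := by
    rw [tdgGates, List.pairwise_map]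
    exact B.indep.imp fun h => by simpa [Gate.qubits] using h.target_ne

/-- The layer of the CNOT gates which open the ladder. -/
def cnotLayer : Layer Q where
  gates := cnotGates B.rungs
  disjoint := by
    rw [cnotGates, List.pairwise_map]
    exact B.indep.imp fun h => h.disjoint

theorem target_ne {r : Rung Q} (hr : r ∈ B.rungs) : r.target ≠ t := fun e =>
  B.notMem_left hr (by simp [Rung.qubits, e])

/-- The layers of a block without the first and the last one, which consist of Hadamard gates. The
gates on the target `t` in the first part of the core share the layer of the gates `T` that open the
ladder if `m₁` holds, and the layer of the gates `T†` if `m₂` holds. -/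
def body (s m₁ m₂ : Bool) : Circuit Q :=
  mergeLayer m₁ (.tGate s t) B.tLayer (fun g hg => by
    obtain ⟨r, hr, rfl⟩ := List.mem_map.1 hg
    rw [qubits_tGate, Finset.disjoint_singleton_left]
    simpa [Gate.qubits] using (B.target_ne hr).symm) ++
  [.single (.CNOT B.ctrl t B.ctrl_ne), B.cnotLayer] ++
  mergeLayer m₂ (.tGate (!s) t) B.tdgLayer (fun g hg => by
    obtain ⟨r, hr, rfl⟩ := List.mem_map.1 hg
    rw [qubits_tGate, Finset.disjoint_singleton_left]
    simpa [Gate.qubits] using (B.target_ne hr).symm) ++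
  serial (closing B.rungs ++ B.coreSecond s ++ invWord (closing B.rungs)) ++
  [B.tdgLayer.inv, B.cnotLayer.inv, B.tLayer.inv]

theorem gates_body (s m₁ m₂ : Bool) : Circuit.gates (B.body s m₁ m₂) = B.bodyWord s := by
  simp [body, bodyWord, Circuit.gates_append, Circuit.gates_cons, Circuit.gates_nil,
    Circuit.gates_serial, Circuit.gates_mergeLayer, tLayer, tdgLayer, cnotLayer, Layer.inv,
    Layer.single]

variable {p : Gate Q → Bool} {h e c r : Bool}

theorem depth_body (hp : IsKind p h e c r) (s m₁ m₂ : Bool) :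
    Circuit.depth p (B.body s m₁ m₂) =
      c.toNat * (4 * B.rungs.length + 6) + h.toNat * (2 * B.rungs.length) +
        e.toNat * (4 * B.rungs.length + 6 + (!m₁).toNat + (!m₂).toNat) := by
  have ht : (tGates B.rungs).any p = e := any_map_const (fun _ => hp.map_T _) B.rungs_ne
  have htdg : (tdgGates B.rungs).any p = e := any_map_const (fun _ => hp.map_Tdg _) B.rungs_ne
  have hcnot : (cnotGates B.rungs).any p = c :=
    any_map_const (fun _ => hp.map_CNOT _ _ _) B.rungs_ne
  simp only [body, Circuit.depth_append, Circuit.depth_cons, Circuit.depth_nil,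
    Circuit.depth_serial, Circuit.depth_mergeLayer, tLayer, tdgLayer, cnotLayer, Layer.inv,
    hp.any_invWord, ht, htdg, hcnot,
    List.countP_append, hp.countP_closing, hp.countP_coreSecond, hp.countP_invWord, hp.map_tGate,
    Layer.single, List.any_cons, List.any_nil, hp.map_CNOT, Bool.or_self, Bool.or_false]
  cases h <;> cases e <;> cases c <;> cases m₁ <;> cases m₂ <;> simp <;> ring

theorem countP_bodyWord (hp : IsKind p h e c r) (s : Bool) : (B.bodyWord s).countP p =
    c.toNat * (6 * B.rungs.length + 4) + h.toNat * (2 * B.rungs.length) +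
      e.toNat * (8 * B.rungs.length + 4) := by
  have ht : (tGates B.rungs).countP p = _ := countP_map_const (fun _ => hp.map_T _) _
  have htdg : (tdgGates B.rungs).countP p = _ := countP_map_const (fun _ => hp.map_Tdg _) _
  have hcnot : (cnotGates B.rungs).countP p = _ := countP_map_const (fun _ => hp.map_CNOT _ _ _) _
  simp only [bodyWord, List.cons_append, List.countP_cons, List.countP_append, hp.countP_invWord,
    ht, htdg, hcnot, hp.countP_closing, hp.countP_coreSecond, hp.map_tGate, hp.map_CNOT]
  cases h <;> cases e <;> cases c <;> simp <;> ring

end Block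

/-- The last layer of the block `B`, a gate on the target, and the first layer of the block `B'`,
all in one layer. -/
def junction (B B' : Block t) (h : ∀ r ∈ B.rungs, ∀ r' ∈ B'.rungs, r.target ≠ r'.target)
    (g : Gate Q) (hg : g.qubits = {t}) : Layer Q where
  gates := invWord (hGates B.rungs) ++ g :: hGates B'.rungs
  disjoint := by
    have h1 : ∀ g₁ ∈ invWord (hGates B.rungs), ∃ r ∈ B.rungs, g₁.qubits = {r.target} := by
      intro g₁ hg₁
      simp only [invWord, hGates, List.map_map, List.mem_reverse, List.mem_map] at hg₁
      obtain ⟨r, hr, rfl⟩ := hg₁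
      exact ⟨r, hr, rfl⟩
    have h2 : ∀ g₁ ∈ hGates B'.rungs, ∃ r ∈ B'.rungs, g₁.qubits = {r.target} := by
      intro g₁ hg₁
      obtain ⟨r, hr, rfl⟩ := List.mem_map.1 hg₁
      exact ⟨r, hr, rfl⟩
    refine List.pairwise_append.2 ⟨pairwise_disjoint_invWord B.hLayer.disjoint,
      List.pairwise_cons.2 ⟨fun g₁ hg₁ => ?_, B'.hLayer.disjoint⟩, fun g₁ hg₁ g₂ hg₂ => ?_⟩
    · obtain ⟨r, hr, e⟩ := h2 g₁ hg₁
      rw [hg, e]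
      simpa using (B'.target_ne hr).symm
    · obtain ⟨r, hr, e⟩ := h1 g₁ hg₁
      rcases List.mem_cons.1 hg₂ with rfl | hg₂
      · rw [hg, e]
        simpa using (B.target_ne hr)
      · obtain ⟨r', hr', e'⟩ := h2 g₂ hg₂
        rw [e, e']
        simpa using h r hr r' hr'

end MainCircuit

/-! ### The commutator circuit -/

/-- The commutator of the blocks and the rotations: all rotations cancel unless both blocks are
active. -/
theorem iZ_rotX_commutator (p q : Prop) [Decidable p] [Decidable q] (θ : ℝ) :
    rotX (-θ) * (if q then iZ false else 1) * rotX θ * (if p then iZ false else 1) * rotX (-θ) *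
      (if q then iZ true else 1) * rotX θ * (if p then iZ true else 1) =
      if p ∧ q then rotX (-4 * θ) else 1 := by
  have h1 : rotX θ * rotX (-θ) = 1 := by rw [rotX_mul, add_neg_cancel, rotX_zero]
  have h2 : rotX (-θ) * rotX θ = 1 := by rw [rotX_mul, neg_add_cancel, rotX_zero]
  by_cases hp : p <;> by_cases hq : q <;> simp only [hp, hq, if_true, if_false, and_self,
    and_true, and_false, mul_one]
  · have h4 := iZ_mul_rotX_mul (-θ)
    have h5 := iZ_mul_rotX_mul (3 * θ)
    rw [neg_neg] at h4
    calc rotX (-θ) * iZ false * rotX θ * iZ false * rotX (-θ) * iZ true * rotX θ * iZ true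
        = rotX (-θ) * iZ false * rotX θ * (iZ false * rotX (-θ) * iZ true) * rotX θ * iZ true := by
          simp only [mul_assoc]
      _ = rotX (-θ) * (iZ false * (rotX θ * rotX θ * rotX θ) * iZ true) := by
          rw [h4]; simp only [mul_assoc]
      _ = rotX (-4 * θ) := by
          rw [rotX_mul, rotX_mul, show θ + θ + θ = 3 * θ by ring, h5, rotX_mul]
          congr 1; ring
  · rw [h2, one_mul, mul_assoc _ (rotX (-θ)), h2, mul_one, iZ_mul]
  · rw [mul_assoc _ (rotX θ), h1, mul_one, mul_assoc _ (iZ false), iZ_mul, mul_one, h2]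
  · rw [h2, one_mul, h2]

section MainCircuit

variable {Q : Type*} [DecidableEq Q] {t : Q}

/-- The whole circuit: the blocks `B` and `B'` and their inverses in the order of a commutator,
interleaved with rotations by `±θ` about the `x`-axis and conjugated by `R_x(a) R_z(b)`. The flags
of the block bodies and `m` fix the T depth: each of the first three blocks saves one layer of T
gates, and another one if `m` holds. -/
def mainCircuit (B B' : Block t) (h : ∀ r ∈ B.rungs, ∀ r' ∈ B'.rungs, r.target ≠ r'.target)
    (a b θ : ℝ) (m : Bool) : Circuit Q :=
  serial [.Rx (-a) t, .Rz (-b) t] ++ [B.hLayer] ++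
  B.body true true m ++ [junction B B' h (.Rx θ t) rfl] ++
  B'.body true true m ++
  [junction B' B (fun r hr r' hr' => (h r' hr' r hr).symm) (.Rx (-θ) t) rfl] ++
  B.body false true m ++ [junction B B' h (.Rx θ t) rfl] ++
  B'.body false false false ++ [B'.hLayer.inv] ++ serial [.Rx (-θ) t, .Rz b t, .Rx a t]

/-- The gates of the main circuit in order of time. -/
def mainWord (B B' : Block t) (a b θ : ℝ) : List (Gate Q) :=
  [.Rx (-a) t, .Rz (-b) t] ++ B.word true ++ [.Rx θ t] ++ B'.word true ++ [.Rx (-θ) t] ++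
    B.word false ++ [.Rx θ t] ++ B'.word false ++ [.Rx (-θ) t, .Rz b t, .Rx a t]

variable (B B' : Block t) (h : ∀ r ∈ B.rungs, ∀ r' ∈ B'.rungs, r.target ≠ r'.target)
  (a b θ : ℝ) (m : Bool)

theorem gates_mainCircuit : Circuit.gates (mainCircuit B B' h a b θ m) = mainWord B B' a b θ := by
  simp only [mainCircuit, mainWord, Circuit.gates_append, Circuit.gates_cons,
    Circuit.gates_serial, Block.gates_body, Block.word, junction, Block.hLayer, Layer.inv,
    List.append_assoc, List.cons_append, List.nil_append]

theorem cost_mainCircuit {p : Gate Q → Bool} {kh ke kc kr : Bool} (hp : IsKind p kh ke kc kr) :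
    Circuit.cost p (mainCircuit B B' h a b θ m) =
      kr.toNat * 8 + kc.toNat * (12 * (B.rungs.length + B'.rungs.length) + 16) +
        ke.toNat * (16 * (B.rungs.length + B'.rungs.length) + 16) +
        kh.toNat * (8 * (B.rungs.length + B'.rungs.length)) := by
  have hh : ∀ C : Block t, (hGates C.rungs).countP p = _ := fun C =>
    countP_map_const (fun _ => hp.map_H _) _
  simp only [Circuit.cost, gates_mainCircuit, mainWord, Block.word, List.countP_append,
    List.countP_cons, List.countP_nil, hp.countP_invWord, hh, Block.countP_bodyWord _ hp, hp.map_Rx,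
    hp.map_Rz]
  cases kh <;> cases ke <;> cases kc <;> cases kr <;> simp <;> ring

theorem depth_mainCircuit {p : Gate Q → Bool} {kh ke kc : Bool} (hp : IsKind p kh ke kc false) :
    Circuit.depth p (mainCircuit B B' h a b θ m) =
      kc.toNat * (8 * (B.rungs.length + B'.rungs.length) + 24) +
        kh.toNat * (4 * (B.rungs.length + B'.rungs.length) + 5) +
        ke.toNat * (8 * (B.rungs.length + B'.rungs.length) + 26 + 3 * (!m).toNat) := by
  have hh : ∀ C : Block t, (hGates C.rungs).any p = kh := fun C =>
    any_map_const (fun _ => hp.map_H _) C.rungs_ne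
  simp only [mainCircuit, Circuit.depth_append, Circuit.depth_cons, Circuit.depth_nil,
    Circuit.depth_serial, Block.depth_body _ hp, junction, Block.hLayer, Layer.inv, hp.any_invWord,
    List.any_append, List.any_cons, hh, hp.map_Rx, hp.map_Rz, List.countP_cons, List.countP_nil]
  cases kh <;> cases ke <;> cases kc <;> cases m <;> simp <;> ring

theorem qubits_invWord {S : Finset Q} {w : List (Gate Q)} (hw : ∀ g ∈ w, g.qubits ⊆ S) :
    ∀ g ∈ invWord w, g.qubits ⊆ S := fun g hg => by
  obtain ⟨g', hg', rfl⟩ := List.mem_map.1 (List.mem_reverse.1 hg)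
  exact g'.qubits_inv ▸ hw g' hg'

theorem Block.qubits_word {S : Finset Q} (ht : t ∈ S) (hc : B.ctrl ∈ S) (ha : B.anc ∈ S)
    (hr : ∀ r ∈ B.rungs, r.qubits ⊆ S) (s : Bool) : ∀ g ∈ B.word s, g.qubits ⊆ S := by
  have hl : ∀ g ∈ opening B.rungs ++ closing B.rungs, g.qubits ⊆ S := fun g hg => by
    obtain ⟨r, hr', h'⟩ := qubits_ladder hg
    exact h'.trans (hr r hr')
  have hl' := qubits_invWord hl
  simp only [opening, invWord_append, List.forall_mem_append] at hl hl'
  have hT : ∀ s, (Gate.tGate s t).qubits ⊆ S := fun s => by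
    rw [qubits_tGate]; simpa using ht
  have hC : (Gate.CNOT B.ctrl t B.ctrl_ne).qubits ⊆ S := by
    simp [Gate.qubits, Finset.insert_subset_iff, ht, hc]
  have hA : (Gate.CNOT B.anc t B.anc_ne).qubits ⊆ S := by
    simp [Gate.qubits, Finset.insert_subset_iff, ht, ha]
  obtain ⟨⟨⟨⟨h1, h2⟩, h3⟩, h4⟩, h5⟩ := hl
  obtain ⟨h1', h2', h3', h4', h5'⟩ := hl'
  simp only [Block.word, Block.bodyWord, Block.coreSecond, List.forall_mem_append,
    List.forall_mem_cons, List.cons_append]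
  simp only [hT, hC, hA, List.not_mem_nil, false_imp_iff, implies_true, true_and, and_true]
  tauto

variable [Fintype Q]

theorem prod_fiberOp (t : Q) (l : List (BasisState Q → Matrix (Fin 2) (Fin 2) ℂ))
    (hl : ∀ F ∈ l, ∀ x b, F (Function.update x t b) = F x) :
    (l.map (fiberOp t)).prod = fiberOp t fun x => (l.map fun F => F x).prod := by
  induction l with
  | nil => simp [fiberOp_one]
  | cons F l ih =>
    rw [List.map_cons, List.prod_cons, ih fun F hF => hl F (List.mem_cons_of_mem _ hF),
      fiberOp_mul _ _ (hl F List.mem_cons_self)]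
    simp

theorem wordOp_mainWord : wordOp (mainWord B B' a b θ) = fiberOp t fun x =>
    if B.Active x ∧ B'.Active x then rotX a * rotZ b * rotX (-4 * θ) * rotZ (-b) * rotX (-a)
    else 1 := by
  have hx : ∀ θ, (Gate.Rx θ t).op = fiberOp t fun _ => rotX θ := fun _ => rfl
  have hz : ∀ θ, (Gate.Rz θ t).op = fiberOp t fun _ => rotZ θ := fun _ => rfl
  have hB : ∀ (B : Block t) (s : Bool) (x : BasisState Q) (b : Fin 2),
      (if B.Active (Function.update x t b) then iZ s else 1) = if B.Active x then iZ s else 1 :=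
    fun B s x b => by simp only [B.active_update]
  have h1 : wordOp (mainWord B B' a b θ) = (List.map (fiberOp t) [fun _ => rotX a, fun _ => rotZ b,
      fun _ => rotX (-θ), fun x => if B'.Active x then iZ false else 1, fun _ => rotX θ,
      fun x => if B.Active x then iZ false else 1, fun _ => rotX (-θ),
      fun x => if B'.Active x then iZ true else 1, fun _ => rotX θ,
      fun x => if B.Active x then iZ true else 1, fun _ => rotZ (-b),
      fun _ => rotX (-a)]).prod := by
    simp only [mainWord, wordOp_append, wordOp_cons, wordOp_nil, one_mul, Block.wordOp_word, hx, hz,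
      List.map_cons, List.map_nil, List.prod_cons, List.prod_nil, mul_one, mul_assoc]
  rw [h1, prod_fiberOp]
  · congr 1
    funext x
    have h2 := iZ_rotX_commutator (B.Active x) (B'.Active x) θ
    simp only [List.map_cons, List.map_nil, List.prod_cons, List.prod_nil, mul_one]
    calc _ = rotX a * rotZ b * (rotX (-θ) * (if B'.Active x then iZ false else 1) * rotX θ *
          (if B.Active x then iZ false else 1) * rotX (-θ) * (if B'.Active x then iZ true else 1) *
          rotX θ * (if B.Active x then iZ true else 1)) * rotZ (-b) * rotX (-a) := by
            simp only [mul_assoc]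
      _ = _ := by
        rw [h2]
        split_ifs
        · rfl
        · rw [mul_one, mul_assoc (rotX a), rotZ_mul, add_neg_cancel, rotZ_zero, mul_one, rotX_mul,
            add_neg_cancel, rotX_zero]
  · simp only [List.forall_mem_cons, hB]
    simp

end MainCircuit

/-! ### Ladders whose targets are the controls of each other -/

section Interleaved

variable {Q : Type*}

/-- The qubits `u 0, …, u (m + 2)` and `v 0, …, v m` are distinct. -/
structure LadderQubits (u v : ℕ → Q) (m : ℕ) : Prop where
  inj_left : ∀ i j, i ≤ m + 2 → j ≤ m + 2 → u i = u j → i = j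
  inj_right : ∀ i j, i ≤ m → j ≤ m → v i = v j → i = j
  ne : ∀ i j, i ≤ m + 2 → j ≤ m → u i ≠ v j

theorem LadderQubits.tail {u v : ℕ → Q} {m : ℕ} (h : LadderQubits u v (m + 1)) :
    LadderQubits (fun i => u (i + 1)) (fun i => v (i + 1)) m where
  inj_left i j hi hj e := Nat.succ.inj (h.inj_left _ _ (by omega) (by omega) e)
  inj_right i j hi hj e := Nat.succ.inj (h.inj_right _ _ (by omega) (by omega) e)
  ne i j hi hj := h.ne _ _ (by omega) (by omega)

/-- The ladder with the targets `v 0, …, v m` and the controls `u 1, …, u (m + 2)`. The last rung is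
controlled by `u (m + 1)` and `u (m + 2)`; the rung with the target `v j`, `j < m`, is controlled by
`u (j + 1)` and, on the state `0`, by `v (j + 1)`. -/
def ladderRungs (u v : ℕ → Q) : (m : ℕ) → LadderQubits u v m → List (Rung Q)
  | 0, h => [⟨v 0, u 1, u 2, true, h.ne _ _ (by omega) (by omega), h.ne _ _ (by omega) (by omega)⟩]
  | m + 1, h => ⟨v 0, u 1, v 1, false, h.ne _ _ (by omega) (by omega), fun e => by
      simpa using h.inj_right _ _ (by omega) (by omega) e⟩ ::
      ladderRungs (fun i => u (i + 1)) (fun i => v (i + 1)) m h.tail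

theorem length_ladderRungs (u v : ℕ → Q) (m : ℕ) (h : LadderQubits u v m) :
    (ladderRungs u v m h).length = m + 1 := by
  induction m generalizing u v with
  | zero => rfl
  | succ m ih => rw [ladderRungs, List.length_cons, ih]

theorem target_ladderRungs {u v : ℕ → Q} {m : ℕ} {h : LadderQubits u v m} {r : Rung Q}
    (hr : r ∈ ladderRungs u v m h) : ∃ j ≤ m, r.target = v j := by
  induction m generalizing u v with
  | zero =>
    rw [ladderRungs, List.mem_singleton] at hr
    exact ⟨0, le_rfl, by rw [hr]⟩
  | succ m ih =>
    rcases List.mem_cons.1 hr with rfl | hr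
    · exact ⟨0, by omega, rfl⟩
    · obtain ⟨j, hj, e⟩ := ih hr
      exact ⟨j + 1, by omega, e⟩

/-- The ladder with the targets `v 0, …, v m` leaves `v 0` in the state `0`. -/
def Ready (x : BasisState Q) : (u v : ℕ → Q) → ℕ → Prop
  | u, v, 0 => x (v 0) = 1 ↔ x (u 1) = 1 ∧ x (u 2) = 1
  | u, v, m + 1 => x (v 0) = 1 ↔ x (u 1) = 1 ∧ Ready x (fun i => u (i + 1)) (fun i => v (i + 1)) m

/-- Once the first controls of both ladders are in the state `1`, so is the first target of each of
them. By recursion, the two ladders together check all qubits. -/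
theorem ready_and_ready_iff (x : BasisState Q) (u v : ℕ → Q) {k l : ℕ} (h1 : l ≤ k)
    (h2 : k ≤ l + 1) (hu : x (u 0) = 1) (hv : x (v 0) = 1) :
    Ready x u v k ∧ Ready x v u l ↔ (∀ i ≤ k + 2, x (u i) = 1) ∧ ∀ i ≤ l + 2, x (v i) = 1 := by
  have hall : ∀ (w : ℕ → Q) (n : ℕ), x (w 0) = 1 →
      ((∀ i ≤ n + 1, x (w i) = 1) ↔ ∀ i ≤ n, x (w (i + 1)) = 1) := fun w n hw =>
    ⟨fun h i hi => h _ (by omega), fun h i hi => by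
      cases i with
      | zero => exact hw
      | succ i => exact h i (by omega)⟩
  induction l generalizing u v k with
  | zero =>
    have h3 : ∀ w : ℕ → Q, x (w 0) = 1 →
        ((∀ i ≤ 2, x (w i) = 1) ↔ x (w 1) = 1 ∧ x (w 2) = 1) := fun w hw => by
      rw [hall w 1 hw]
      refine ⟨fun h => ⟨h 0 (by omega), h 1 (by omega)⟩, fun h i hi => ?_⟩
      interval_cases i
      exacts [h.1, h.2]
    obtain rfl | rfl : k = 0 ∨ k = 1 := by omega
    · simp only [Ready, hu, hv, true_iff, h3 u hu, h3 v hv]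
    · rw [hall u 2 hu, h3 v hv]
      simp only [Ready, hu, hv, true_iff]
      refine ⟨fun ⟨⟨hu1, h⟩, hv1, hv2⟩ => ⟨(h3 (fun i => u (i + 1)) hu1).2 (h.1 hv1), hv1, hv2⟩,
        fun ⟨h, hv1, hv2⟩ => ?_⟩
      exact ⟨⟨h 0 (by omega), iff_of_true hv1 ⟨h 1 (by omega), h 2 (by omega)⟩⟩, hv1, hv2⟩
  | succ l ih =>
    obtain ⟨k, rfl⟩ : ∃ k', k = k' + 1 := ⟨k - 1, by omega⟩
    rw [show k + 1 + 2 = (k + 2) + 1 by rfl, show l + 1 + 2 = (l + 2) + 1 by rfl,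
      hall u (k + 2) hu, hall v (l + 2) hv]
    simp only [Ready, hu, hv, true_iff]
    have ih' := fun hu1 hv1 => ih (k := k) (fun i => u (i + 1)) (fun i => v (i + 1)) (by omega)
      (by omega) hu1 hv1
    refine ⟨fun ⟨⟨hu1, h⟩, hv1, h'⟩ => (ih' hu1 hv1).1 ⟨h, h'⟩, fun h => ?_⟩
    have hu1 := h.1 0 (by omega)
    have hv1 := h.2 0 (by omega)
    have := (ih' hu1 hv1).2 h
    exact ⟨⟨hu1, this.1⟩, hv1, this.2⟩

variable [DecidableEq Q]

theorem qubits_ladderRungs {u v : ℕ → Q} {m : ℕ} {h : LadderQubits u v m} {r : Rung Q}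
    (hr : r ∈ ladderRungs u v m h) {q : Q} (hq : q ∈ r.qubits) :
    (∃ i ≤ m + 1, q = u (i + 1)) ∨ ∃ j ≤ m, q = v j := by
  induction m generalizing u v with
  | zero =>
    rw [ladderRungs, List.mem_singleton] at hr
    subst hr
    simp only [Rung.qubits, Finset.mem_insert, Finset.mem_singleton] at hq
    rcases hq with rfl | rfl | rfl
    · exact Or.inr ⟨0, le_rfl, rfl⟩
    · exact Or.inl ⟨0, by omega, rfl⟩
    · exact Or.inl ⟨1, by omega, rfl⟩
  | succ m ih =>
    rcases List.mem_cons.1 hr with rfl | hr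
    · simp only [Rung.qubits, Finset.mem_insert, Finset.mem_singleton] at hq
      rcases hq with rfl | rfl | rfl
      · exact Or.inr ⟨0, by omega, rfl⟩
      · exact Or.inl ⟨0, by omega, rfl⟩
      · exact Or.inr ⟨1, by omega, rfl⟩
    · rcases ih hr with ⟨i, hi, e⟩ | ⟨j, hj, e⟩
      · exact Or.inl ⟨i + 1, by omega, e⟩
      · exact Or.inr ⟨j + 1, by omega, e⟩

theorem notMem_tail_ladderRungs {u v : ℕ → Q} {m : ℕ} (h : LadderQubits u v (m + 1)) {r : Rung Q}
    (hr : r ∈ ladderRungs (fun i => u (i + 1)) (fun i => v (i + 1)) m h.tail) :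
    v 0 ∉ r.qubits ∧ u 1 ∉ r.qubits := by
  constructor <;> intro hq <;> rcases qubits_ladderRungs hr hq with ⟨i, hi, e⟩ | ⟨j, hj, e⟩
  · exact h.ne _ _ (by omega) (by omega) e.symm
  · simpa using h.inj_right _ _ (by omega) (by omega) e
  · simpa using h.inj_left _ _ (by omega) (by omega) e
  · exact h.ne _ _ (by omega) (by omega) e

theorem pairwise_ladderRungs (u v : ℕ → Q) (m : ℕ) (h : LadderQubits u v m) :
    (ladderRungs u v m h).Pairwise Rung.Indep := by
  induction m generalizing u v with
  | zero => exact List.pairwise_singleton _ _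
  | succ m ih =>
    exact List.pairwise_cons.2 ⟨fun r hr => notMem_tail_ladderRungs h hr, ih _ _ h.tail⟩

theorem Rung.act_target_ne_one_iff (r : Rung Q) (x : BasisState Q) :
    r.act x r.target ≠ 1 ↔
      (x r.target = 1 ↔ x r.ctrl = 1 ∧ (x r.prev = 1 ↔ r.active = true)) := by
  have h0 : ∀ i : Fin 2, i + 1 ≠ 1 ↔ i = 1 := by decide
  rw [Rung.act]
  split_ifs with h
  · simp [h, h0]
  · simp [h]

theorem ladderAct_ne_one_iff (x : BasisState Q) (u v : ℕ → Q) (m : ℕ) (h : LadderQubits u v m) :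
    ladderAct (ladderRungs u v m h) x (v 0) ≠ 1 ↔ Ready x u v m := by
  induction m generalizing u v with
  | zero =>
    rw [ladderRungs, ladderAct, ladderAct, Function.comp, id]
    refine (Rung.act_target_ne_one_iff _ x).trans ?_
    simp [Ready]
  | succ m ih =>
    rw [ladderRungs, ladderAct, Function.comp]
    refine (Rung.act_target_ne_one_iff _ _).trans ?_
    have h1 : ladderAct (ladderRungs _ _ m h.tail) x (v 0) = x (v 0) :=
      ladderAct_apply_of_notMem (fun r hr => (notMem_tail_ladderRungs h hr).1) x
    have h2 : ladderAct (ladderRungs _ _ m h.tail) x (u 1) = x (u 1) :=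
      ladderAct_apply_of_notMem (fun r hr => (notMem_tail_ladderRungs h hr).2) x
    have h3 := ih _ _ h.tail
    simp only [zero_add] at h3
    simp only [h1, h2, Ready, Bool.false_eq_true, iff_false]
    rw [← h3]

/-- The block whose ladder has the targets `v 0, …, v m` and the controls `u 1, …, u (m + 2)`, and
whose core is controlled by `u 0` and by the state `0` of `v 0`. -/
def ladderBlock {t : Q} (u v : ℕ → Q) (m : ℕ) (h : LadderQubits u v m) (hu : ∀ i ≤ m + 2, u i ≠ t)
    (hv : ∀ j ≤ m, v j ≠ t) : Block t where
  ctrl := u 0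
  anc := v 0
  rungs := ladderRungs u v m h
  ctrl_ne := hu _ (by omega)
  anc_ne := hv _ (by omega)
  rungs_ne := by cases m <;> simp [ladderRungs]
  indep := pairwise_ladderRungs u v m h
  disjoint r hr := by
    rw [Finset.disjoint_left]
    intro q hq hqr
    rw [Finset.mem_insert, Finset.mem_singleton] at hq
    rcases qubits_ladderRungs hr hqr with ⟨i, hi, rfl⟩ | ⟨j, hj, rfl⟩
    · rcases hq with hq | hq
      · exact hu _ (by omega) hq
      · simpa using h.inj_left _ _ (by omega) (by omega) hq
    · rcases hq with hq | hq
      · exact hv _ hj hq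
      · exact h.ne _ _ (by omega) hj hq.symm

end Interleaved

end

theorem mainTheorem1 {Q : Type*} [Fintype Q] [DecidableEq Q] (n : ℕ) (hn : 6 ≤ n)
    (C : Finset Q) (hC : C.card = n) (t : Q) (ht : t ∉ C)
    (W : Matrix (Fin 2) (Fin 2) ℂ) (hW : W ∈ Matrix.specialUnitaryGroup (Fin 2) ℂ) :
    ∃ c : Circuit Q,
      Circuit.op c = controlled C t W ∧
      Circuit.ActsOn c (insert t C) ∧
      Circuit.cost Gate.isRotation c = 8 ∧
      Circuit.cost Gate.isCNOT c = 12 * n - 32 ∧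
      Circuit.depth Gate.isCNOT c = 8 * n - 8 ∧
      Circuit.cost Gate.isT c = 16 * n - 48 ∧
      Circuit.depth Gate.isT c = (if Even n then 8 * n - 6 else 8 * n - 3) ∧
      Circuit.cost Gate.isH c = 8 * n - 32 ∧
      Circuit.depth Gate.isH c = 4 * n - 11 := by
  obtain ⟨a, b, l, rfl⟩ := exists_rotX_rotZ_conj W hW
  -- Two groups of `k + 3` and `k' + 3` controls, with `k' ≤ k ≤ k' + 1`.
  obtain ⟨k, k', hk, hk', rfl⟩ : ∃ k k', k' ≤ k ∧ k ≤ k' + 1 ∧ n = k + k' + 6 :=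
    ⟨(n + 1) / 2 - 3, n / 2 - 3, by omega, by omega, by omega⟩
  let e := C.equivFinOfCardEq hC
  -- All controls in a row; the value `t` beyond them is never used.
  let w : ℕ → Q := fun i => if h : i < k + k' + 6 then e.symm ⟨i, h⟩ else t
  have hw : ∀ i (h : i < k + k' + 6), w i = e.symm ⟨i, h⟩ := fun i h => dif_pos h
  have hwC : ∀ i < k + k' + 6, w i ∈ C := fun i h => by rw [hw i h]; exact (e.symm _).2
  have hwt : ∀ i < k + k' + 6, w i ≠ t := fun i h e => ht (e ▸ hwC i h)
  have hinj : ∀ i < k + k' + 6, ∀ j < k + k' + 6, w i = w j → i = j := fun i hi j hj h => by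
    rw [hw i hi, hw j hj] at h
    simpa using e.symm.injective (Subtype.ext h)
  have hsurj : ∀ c ∈ C, ∃ i < k + k' + 6, w i = c := fun c hc =>
    ⟨e ⟨c, hc⟩, (e ⟨c, hc⟩).2, by rw [hw _ (e ⟨c, hc⟩).2]; simp⟩
  let v : ℕ → Q := fun i => w (k + 3 + i)
  have h₁ : LadderQubits w v k :=
    ⟨fun i j hi hj => hinj i (by omega) j (by omega),
      fun i j hi hj h => by have := hinj _ (by omega) _ (by omega) h; omega,
      fun i j hi hj h => by have := hinj _ (by omega) _ (by omega) h; omega⟩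
  have h₂ : LadderQubits v w k' :=
    ⟨fun i j hi hj h => by have := hinj _ (by omega) _ (by omega) h; omega,
      fun i j hi hj => hinj i (by omega) j (by omega),
      fun i j hi hj h => by have := hinj _ (by omega) _ (by omega) h; omega⟩
  let B : Block t :=
    ladderBlock w v k h₁ (fun i hi => hwt _ (by omega)) fun i hi => hwt _ (by omega)
  let B' : Block t :=
    ladderBlock v w k' h₂ (fun i hi => hwt _ (by omega)) fun i hi => hwt _ (by omega)
  have hBB' : ∀ r ∈ B.rungs, ∀ r' ∈ B'.rungs, r.target ≠ r'.target := fun r hr r' hr' h => by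
    obtain ⟨i, hi, hi'⟩ := target_ladderRungs hr
    obtain ⟨j, hj, hj'⟩ := target_ladderRungs hr'
    have := hinj _ (by omega) _ (by omega) ((hi'.symm.trans h).trans hj')
    omega
  have hlen : B.rungs.length = k + 1 := length_ladderRungs _ _ _ _
  have hlen' : B'.rungs.length = k' + 1 := length_ladderRungs _ _ _ _
  have hactive : ∀ x : BasisState Q, B.Active x ∧ B'.Active x ↔ ∀ c ∈ C, x c = 1 := by
    intro x
    have e1 : B.Active x ↔ x (w 0) = 1 ∧ Ready x w v k :=
      and_congr_right fun _ => ladderAct_ne_one_iff x w v k h₁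
    have e2 : B'.Active x ↔ x (v 0) = 1 ∧ Ready x v w k' :=
      and_congr_right fun _ => ladderAct_ne_one_iff x v w k' h₂
    rw [e1, e2]
    constructor
    · rintro ⟨⟨hu, h3⟩, hv, h4⟩ c hc
      obtain ⟨h5, h6⟩ := (ready_and_ready_iff x w v hk hk' hu hv).1 ⟨h3, h4⟩
      obtain ⟨i, hi, rfl⟩ := hsurj c hc
      by_cases hik : i ≤ k + 2
      · exact h5 i hik
      · have := h6 (i - (k + 3)) (by omega)
        rwa [show v (i - (k + 3)) = w i from congrArg w (by omega)] at this
    · intro h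
      have hu : ∀ i ≤ k + 2, x (w i) = 1 := fun i hi => h _ (hwC i (by omega))
      have hv : ∀ i ≤ k' + 2, x (v i) = 1 := fun i hi => h _ (hwC _ (by omega))
      have := (ready_and_ready_iff x w v hk hk' (hu 0 (by omega)) (hv 0 (by omega))).2 ⟨hu, hv⟩
      exact ⟨⟨hu 0 (by omega), this.1⟩, hv 0 (by omega), this.2⟩
  refine ⟨mainCircuit B B' hBB' a b (-(l / 4)) (decide (Even (k + k' + 6))),
    ?_, ?_, ?_, ?_, ?_, ?_, ?_, ?_, ?_⟩
  · change wordOp (Circuit.gates _) = _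
    rw [gates_mainCircuit, wordOp_mainWord, controlled_eq_fiberOp]
    simp only [hactive, show -4 * -(l / 4) = l by ring]
  · have hmem : ∀ i < k + k' + 6, w i ∈ insert t C := fun i hi =>
      Finset.mem_insert_of_mem (hwC i hi)
    have hB : ∀ s, ∀ g ∈ B.word s, g.qubits ⊆ insert t C :=
      B.qubits_word (Finset.mem_insert_self t C) (hmem 0 (by omega)) (hmem (k + 3) (by omega))
        fun r hr q hq => by
          rcases qubits_ladderRungs hr hq with ⟨i, hi, rfl⟩ | ⟨j, hj, rfl⟩ <;>
          exact hmem _ (by omega)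
    have hB' : ∀ s, ∀ g ∈ B'.word s, g.qubits ⊆ insert t C :=
      B'.qubits_word (Finset.mem_insert_self t C) (hmem (k + 3) (by omega)) (hmem 0 (by omega))
        fun r hr q hq => by
          rcases qubits_ladderRungs hr hq with ⟨i, hi, rfl⟩ | ⟨j, hj, rfl⟩ <;>
          exact hmem _ (by omega)
    have hx : ∀ θ, (Gate.Rx θ t).qubits ⊆ insert t C := fun _ => by simp [Gate.qubits]
    have hz : ∀ θ, (Gate.Rz θ t).qubits ⊆ insert t C := fun _ => by simp [Gate.qubits]
    rw [Circuit.ActsOn, gates_mainCircuit]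
    simp only [mainWord, List.forall_mem_append, List.forall_mem_cons, hx, hz, List.not_mem_nil,
      false_imp_iff, implies_true, true_and, and_true]
    exact ⟨⟨⟨hB true, hB' true⟩, hB false⟩, hB' false⟩
  · rw [cost_mainCircuit _ _ _ _ _ _ _ isKind_isRotation]
    simp
  · rw [cost_mainCircuit _ _ _ _ _ _ _ isKind_isCNOT, hlen, hlen']
    simp; omega
  · rw [depth_mainCircuit _ _ _ _ _ _ _ isKind_isCNOT, hlen, hlen']
    simp; omega
  · rw [cost_mainCircuit _ _ _ _ _ _ _ isKind_isT, hlen, hlen']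
    simp; omega
  · rw [depth_mainCircuit _ _ _ _ _ _ _ isKind_isT, hlen, hlen']
    by_cases he : Even (k + k' + 6) <;> simp only [he] <;> simp <;> omega
  · rw [cost_mainCircuit _ _ _ _ _ _ _ isKind_isH, hlen, hlen']
    simp; omega
  · rw [depth_mainCircuit _ _ _ _ _ _ _ isKind_isH, hlen, hlen']
    simp; omega
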